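/- Let $G$ be a finite simple graph with vertex set $V(G)=\{u_1,\dots,u_n\}$, where $n\ge 3$, let $m$ be its number of edges, and let $r$ be a restraint on $G$, i.e. a function assigning to every vertex $v$ a finite set $r(v)\subset\{1,2,3,\dots\}$ of forbidden colours. For an integer $x\ge 0$ let $\pi_r(G,x)$ be the number of functions $c:V(G)\to\{1,\dots,x\}$ such that $c(u)\ne c(v)$ for every edge $uv$ and $c(v)\notin r(v)$ for every vertex $v$. Let $M_{G,r}$ be the largest element of $\bigcup_v r(v)$, or $0$ if this union is empty. Let $N(u)$ denote the neighbourhood of $u$, $\eta_G(H)$ the number of subgraphs of $G$ isomorphic to $H$, and $i_G(H)$ the number of induced subgraphs of $G$ isomorphic to $H$. **Theorem.** There are unique integers $a_0(G,r),\dots,a_n(G,r)$ such that $\pi_r(G,x)=\sum_{i=0}^n(-1)^{n-i}a_i(G,r)\,x^i$ for all integers $x\ge M_{G,r}$, and $$a_{n-3}(G,r)=A_0(G)+\sum_{i=1}^{8}A_i(G,r),$$ where (sums over $u_iu_j\in E(G)$ run once over each edge) $$\begin{aligned} A_0(G)&=\binom m3-(m-2)\,\eta_G(C_3)-i_G(C_4)+2\,\eta_G(K_4),\\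 A_1(G,r)&=\sum_{i<j<k}|r(u_i)|\,|r(u_j)|\,|r(u_k)|,\\ A_2(G,r)&=(m-1)\sum_{i<j}|r(u_i)|\,|r(u_j)|,\\ A_3(G,r)&=\sum_{i<j,\ u_iu_j\notin E(G)}|r(u_i)|\,|r(u_j)|,\\ A_4(G,r)&=-\sum_{u_iu_j\in E(G)}|r(u_i)\cap r(u_j)|\sum_{k\notin\{i,j\}}|r(u_k)|,\\ A_5(G,r)&=\Bigl(\binom m2-\eta_G(C_3)\Bigr)\sum_{i}|r(u_i)|,\\ A_6(G,r)&=-(m-1)\sum_{u_iu_j\in E(G)}|r(u_i)\cap r(u_j)|,\\ A_7(G,r)&=\sum_{u_iu_j\in E(G)}|N(u_i)\cap N(u_j)|\,|r(u_i)\cap r(u_j)|-\sum_{i}\ \sum_{j<k,\ u_j,u_k\in N(u_i)}|r(u_j)\cap r(u_k)|,\\ A_8(G,r)&=\frac12\sum_{u_iu_j\in E(G)}\ \sum_{k\notin\{i,j\},\ u_k\in N(u_i)\cup N(u_j)}|r(u_i)\cap r(u_j)\cap r(u_k)|+\frac16\sum_{u_iu_j\in E(G)}\ \sum_{u_k\in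 N(u_i)\cap N(u_j)}|r(u_i)\cap r(u_j)\cap r(u_k)|. \end{aligned}$$ -/

import Mathlib

namespace RestrainedColouring

section Colourings

variable {V : Type*} [Fintype V] [DecidableEq V]

/-- The proper `x`-colourings of `G`, with colours `1, …, x`, that are permitted by the
restraint `r` (which lists the finite set `r v` of forbidden colours at each vertex `v`). -/
def permittedColourings (G : SimpleGraph V) [DecidableRel G.Adj] (r : V → Finset ℕ) (x : ℕ) :
    Finset (V → ℕ) :=
  (Fintype.piFinset fun _ : V => Finset.Icc 1 x).filter fun c =>
    (∀ u v, G.Adj u v → c u ≠ c v) ∧ ∀ v, c v ∉ r v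

/-- `π_r(G, x)`: the number of proper `x`-colourings of `G` permitted by `r`. -/
def restrainedCount (G : SimpleGraph V) [DecidableRel G.Adj] (r : V → Finset ℕ) (x : ℕ) : ℕ :=
  (permittedColourings G r x).card

/-- `M_{G,r}`: the largest colour in `⋃ v, r v`, and `0` if that union is empty. -/
def maxForbidden (r : V → Finset ℕ) : ℕ :=
  (Finset.univ.biUnion r).sup id

/-- `π_r(G, x) = ∑_{i=0}^n (-1)^(n-i) a_i x^i` for all `x ≥ M_{G,r}`, where `n` is the number of
vertices of `G`. -/
def HasCoefficients (G : SimpleGraph V) [DecidableRel G.Adj] (r : V → Finset ℕ)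
    (a : Fin (Fintype.card V + 1) → ℤ) : Prop :=
  ∀ x : ℕ, maxForbidden r ≤ x →
    (restrainedCount G r x : ℤ) =
      ∑ i : Fin (Fintype.card V + 1), (-1) ^ (Fintype.card V - (i : ℕ)) * a i * (x : ℤ) ^ (i : ℕ)

end Colourings

/-- `i_G(H)`: the number of induced subgraphs of `G` isomorphic to `H`; an induced subgraph is
determined by its vertex set. -/
noncomputable def inducedCount {V W : Type*} (G : SimpleGraph V) (H : SimpleGraph W) : ℕ :=
  {S : Set V | Nonempty (G.induce S ≃g H)}.ncard

section Formula

/-! The order on `V` is an enumeration `u_1 < u_2 < ⋯ < u_n` of the vertices. A sum over the edges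
`u_i u_j` of `G` is written as a sum over the pairs `i < j` that are adjacent. `G.copyCount H` is
the number `η_G(H)` of subgraphs of `G` isomorphic to `H`. -/

variable {V : Type*} [Fintype V] [LinearOrder V]

/-- `A_0 = C(m, 3) - (m - 2) η_G(C_3) - i_G(C_4) + 2 η_G(K_4)`. -/
noncomputable def A0 (G : SimpleGraph V) [DecidableRel G.Adj] : ℚ :=
  (G.edgeFinset.card.choose 3 : ℚ)
    - ((G.edgeFinset.card : ℚ) - 2) * (G.copyCount (SimpleGraph.cycleGraph 3) : ℚ)
    - (inducedCount G (SimpleGraph.cycleGraph 4) : ℚ)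
    + 2 * (G.copyCount (SimpleGraph.completeGraph (Fin 4)) : ℚ)

/-- `A_1 = ∑_{i<j<k} |r(u_i)| |r(u_j)| |r(u_k)|`. -/
def A1 (r : V → Finset ℕ) : ℚ :=
  ∑ i, ∑ j with i < j, ∑ k with j < k,
    ((r i).card : ℚ) * ((r j).card : ℚ) * ((r k).card : ℚ)

/-- `A_2 = (m - 1) ∑_{i<j} |r(u_i)| |r(u_j)|`. -/
def A2 (G : SimpleGraph V) [DecidableRel G.Adj] (r : V → Finset ℕ) : ℚ :=
  ((G.edgeFinset.card : ℚ) - 1) * ∑ i, ∑ j with i < j, ((r i).card : ℚ) * ((r j).card : ℚ)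

/-- `A_3 = ∑_{i<j, u_i u_j ∉ E(G)} |r(u_i)| |r(u_j)|`. -/
def A3 (G : SimpleGraph V) [DecidableRel G.Adj] (r : V → Finset ℕ) : ℚ :=
  ∑ i, ∑ j with i < j ∧ ¬ G.Adj i j, ((r i).card : ℚ) * ((r j).card : ℚ)

/-- `A_4 = - ∑_{u_i u_j ∈ E(G)} |r(u_i) ∩ r(u_j)| ∑_{k ∉ {i,j}} |r(u_k)|`. -/
def A4 (G : SimpleGraph V) [DecidableRel G.Adj] (r : V → Finset ℕ) : ℚ :=
  -∑ i, ∑ j with i < j ∧ G.Adj i j,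
    ((r i ∩ r j).card : ℚ) * ∑ k with k ≠ i ∧ k ≠ j, ((r k).card : ℚ)

/-- `A_5 = (C(m, 2) - η_G(C_3)) ∑_i |r(u_i)|`. -/
noncomputable def A5 (G : SimpleGraph V) [DecidableRel G.Adj] (r : V → Finset ℕ) : ℚ :=
  ((G.edgeFinset.card.choose 2 : ℚ) - (G.copyCount (SimpleGraph.cycleGraph 3) : ℚ)) *
    ∑ i, ((r i).card : ℚ)

/-- `A_6 = - (m - 1) ∑_{u_i u_j ∈ E(G)} |r(u_i) ∩ r(u_j)|`. -/
def A6 (G : SimpleGraph V) [DecidableRel G.Adj] (r : V → Finset ℕ) : ℚ :=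
  -((G.edgeFinset.card : ℚ) - 1) * ∑ i, ∑ j with i < j ∧ G.Adj i j, ((r i ∩ r j).card : ℚ)

/-- `A_7' = ∑_{u_i u_j ∈ E(G)} |N(u_i) ∩ N(u_j)| |r(u_i) ∩ r(u_j)|`. -/
def A7' (G : SimpleGraph V) [DecidableRel G.Adj] (r : V → Finset ℕ) : ℚ :=
  ∑ i, ∑ j with i < j ∧ G.Adj i j,
    ((G.neighborFinset i ∩ G.neighborFinset j).card : ℚ) * ((r i ∩ r j).card : ℚ)

/-- `A_7'' = - ∑_i ∑_{j<k, u_j, u_k ∈ N(u_i)} |r(u_j) ∩ r(u_k)|`. -/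
def A7'' (G : SimpleGraph V) [DecidableRel G.Adj] (r : V → Finset ℕ) : ℚ :=
  -∑ i, ∑ j ∈ G.neighborFinset i, ∑ k ∈ G.neighborFinset i with j < k, ((r j ∩ r k).card : ℚ)

/-- `A_7 = A_7' + A_7''`. -/
def A7 (G : SimpleGraph V) [DecidableRel G.Adj] (r : V → Finset ℕ) : ℚ :=
  A7' G r + A7'' G r

/-- `A_8' = 1/2 ∑_{u_i u_j ∈ E(G)} ∑_{k ∉ {i,j}, u_k ∈ N(u_i) ∪ N(u_j)} |r(u_i) ∩ r(u_j) ∩ r(u_k)|`.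
-/
def A8' (G : SimpleGraph V) [DecidableRel G.Adj] (r : V → Finset ℕ) : ℚ :=
  1 / 2 * ∑ i, ∑ j with i < j ∧ G.Adj i j,
    ∑ k ∈ G.neighborFinset i ∪ G.neighborFinset j with k ≠ i ∧ k ≠ j,
      ((r i ∩ r j ∩ r k).card : ℚ)

/-- `A_8'' = 1/6 ∑_{u_i u_j ∈ E(G)} ∑_{u_k ∈ N(u_i) ∩ N(u_j)} |r(u_i) ∩ r(u_j) ∩ r(u_k)|`. -/
def A8'' (G : SimpleGraph V) [DecidableRel G.Adj] (r : V → Finset ℕ) : ℚ :=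
  1 / 6 * ∑ i, ∑ j with i < j ∧ G.Adj i j,
    ∑ k ∈ G.neighborFinset i ∩ G.neighborFinset j, ((r i ∩ r j ∩ r k).card : ℚ)

/-- `A_8 = A_8' + A_8''`. -/
def A8 (G : SimpleGraph V) [DecidableRel G.Adj] (r : V → Finset ℕ) : ℚ :=
  A8' G r + A8'' G r

end Formula

end RestrainedColouring

/-! The engine is deletion–contraction. Let uv be an edge of G and G₀ = G − uv. The permitted
colourings of G₀ with c(u) ≠ c(v) are those of G; the ones with c(u) = c(v) are colourings of the
contraction, where the merged vertex forbids r(u) ∪ r(v). To keep the vertex type fixed,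
`mergeGraph` and `mergeRestraint` leave v behind as an isolated, unrestrained vertex, which
multiplies the count by x. If P and P' are the polynomials of G₀ and of the merged graph, then X
divides P' and P − P'/X is the polynomial of G. The edgeless graph gives ∏ (X − |r(v)|). This is
`exists_polynomial`.

With alternating signs removed, each coefficient of G is the same coefficient of G₀ plus the
preceding one (one degree higher) of the merged graph. So it suffices that the closed forms
`coeffOne`, `coeffTwo`, `coeffThree` satisfy this recursion (`coeffOne_addEntry`,
`coeffTwo_addEntry`, `coeffThree_addEntry`) and agree with elementary symmetric functions of the
|r(v)| on the edgeless graph. For this, all statistics are sums over ordered tuples of vertices of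
products of entries of a rational 0/1 matrix. Filling or merging entries changes such a sum by
explicit terms through u and v, and the recursion becomes a ring identity.

Its graph-theoretic core: let T be the number of common neighbours of u and v in G₀. The edge uv
creates T triangles, some induced four-cycles and some K₄'s, and destroys the induced four-cycles
having uv as a missing diagonal. Merging loses T edges, turns each created four-cycle into a
triangle, and identifies two triangles for each created K₄.

It remains to translate. Subgraph counts are embedding counts divided by automorphism counts
(`card_embedding_eq`), and sums over i < j or over edges are halved sums over ordered pairs
(`sum_lt_eq`, `sum_lt_adj_eq`). The coefficients are unique because a polynomial is determined by
its values at infinitely many integers. -/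

namespace RestrainedColouring

/-! ### Effect of adding or merging entries on sums over pairs, paths and triangles. -/

section MatrixSums

variable {V : Type*} [DecidableEq V]

/-- The matrix `a` with the entries at `(u, v)` and `(v, u)` replaced by `1`. -/
def addEntry (a : V → V → ℚ) (u v : V) (i j : V) : ℚ :=
  if (i = u ∧ j = v) ∨ (i = v ∧ j = u) then 1 else a i j

/-- The adjacency matrix obtained by merging `v` into `u`, leaving `v` isolated. -/
def mergeEntry (a : V → V → ℚ) (u v : V) (i j : V) : ℚ :=
  if i = v ∨ j = v then 0
  else if i = u then a u j + a v j - a u j * a v j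
  else if j = u then a u i + a v i - a u i * a v i
  else a i j

/-- `a` is a symmetric `0/1` matrix with zero diagonal and zero entry at `(u, v)`. -/
structure IsNonEdge (a : V → V → ℚ) (u v : V) : Prop where
  symm : ∀ i j, a i j = a j i
  diag : ∀ i, a i i = 0
  idem : ∀ i j, a i j * a i j = a i j
  ne : u ≠ v
  entry : a u v = 0

lemma IsNonEdge.entry' {V : Type*} {a : V → V → ℚ} {u v : V} (h : IsNonEdge a u v) : a v u = 0 := by
  rw [h.symm, h.entry]

variable [Fintype V] {a : V → V → ℚ} {u v : V}

lemma sum_addEntry (h : IsNonEdge a u v) (w : V → V → ℚ) :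
    ∑ i, ∑ j, addEntry a u v i j * w i j = (∑ i, ∑ j, a i j * w i j) + (w u v + w v u) := by
  have hp : ∀ i j, addEntry a u v i j * w i j = a i j * w i j +
      ((if i = u then if j = v then w u v else 0 else 0) +
        (if i = v then if j = u then w v u else 0 else 0)) := by
    intro i j
    have h1 := h.entry
    have h2 := h.entry'
    have h3 := h.ne
    by_cases iu : i = u <;> by_cases iv : i = v <;> by_cases ju : j = u <;> by_cases jv : j = v <;>
      simp_all [addEntry]
  simp only [hp, Finset.sum_add_distrib]
  simp

/-- New terms are centred at u or v. Since j = k is allowed, both legs may be the new edge; this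
gives the last two weights, which vanish for weights that are zero when j = k. -/
lemma sum_path_addEntry (h : IsNonEdge a u v) (w : V → V → V → ℚ) :
    ∑ i, ∑ j, ∑ k, addEntry a u v i j * addEntry a u v i k * w i j k =
      (∑ i, ∑ j, ∑ k, a i j * a i k * w i j k) +
        ((∑ k, a u k * (w u v k + w u k v)) + (∑ k, a v k * (w v u k + w v k u))
          + (w u v v + w v u u)) := by
  have hp : ∀ i j k, addEntry a u v i j * addEntry a u v i k * w i j k =
      a i j * a i k * w i j k +
      ((if i = u then if j = v then a u k * w u v k else 0 else 0) +
       (if i = u then if k = v then a u j * w u j v else 0 else 0) +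
       (if i = v then if j = u then a v k * w v u k else 0 else 0) +
       (if i = v then if k = u then a v j * w v j u else 0 else 0) +
       ((if i = u then if j = v then if k = v then w u v v else 0 else 0 else 0) +
        (if i = v then if j = u then if k = u then w v u u else 0 else 0 else 0))) := by
    intro i j k
    have h1 := h.entry
    have h2 := h.entry'
    have h3 := h.ne
    have h4 := h.diag
    by_cases iu : i = u <;> by_cases iv : i = v <;> by_cases ju : j = u <;> by_cases jv : j = v <;>
      by_cases ku : k = u <;> by_cases kv : k = v <;>
      simp_all [addEntry]
  simp only [hp, Finset.sum_add_distrib]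
  simp [mul_add, Finset.sum_add_distrib]
  ring

lemma sum_triangle_addEntry (h : IsNonEdge a u v) (w : V → V → V → ℚ) :
    ∑ i, ∑ j, ∑ k, addEntry a u v i j * addEntry a u v i k * addEntry a u v j k * w i j k =
      (∑ i, ∑ j, ∑ k, a i j * a i k * a j k * w i j k) +
        ∑ k, a u k * a v k * (w u v k + w v u k + w u k v + w v k u + w k u v + w k v u) := by
  have hp : ∀ i j k, addEntry a u v i j * addEntry a u v i k * addEntry a u v j k * w i j k =
      a i j * a i k * a j k * w i j k +
      ((if i = u then if j = v then a u k * a v k * w u v k else 0 else 0) +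
       (if i = v then if j = u then a u k * a v k * w v u k else 0 else 0) +
       (if i = u then if k = v then a u j * a v j * w u j v else 0 else 0) +
       (if i = v then if k = u then a u j * a v j * w v j u else 0 else 0) +
       (if j = u then if k = v then a u i * a v i * w i u v else 0 else 0) +
       (if j = v then if k = u then a u i * a v i * w i v u else 0 else 0)) := by
    intro i j k
    have h1 := h.entry
    have h2 := h.entry'
    have h3 := h.ne
    have h4 := h.diag
    have h5 := h.symm i u
    have h6 := h.symm i v
    have h7 := h.symm j u
    have h8 := h.symm j v
    by_cases iu : i = u <;> by_cases iv : i = v <;> by_cases ju : j = u <;> by_cases jv : j = v <;>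
      by_cases ku : k = u <;> by_cases kv : k = v <;>
      simp_all [addEntry, mul_comm, mul_left_comm]
  simp only [hp, Finset.sum_add_distrib]
  simp [mul_add, Finset.sum_add_distrib]

/-- Only triples containing u or v change. As the diagonal is zero, such a triple contributes only
with u or v in a single position, and the three positions give the factor 3. -/
lemma sum_triangle_mergeEntry (h : IsNonEdge a u v) :
    ∑ i, ∑ j, ∑ k, mergeEntry a u v i j * mergeEntry a u v i k * mergeEntry a u v j k =
      (∑ i, ∑ j, ∑ k, a i j * a i k * a j k) +
        3 * ∑ j, ∑ k, a j k * ((a u j + a v j - a u j * a v j) * (a u k + a v k - a u k * a v k)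
          - a u j * a u k - a v j * a v k) := by
  have hp : ∀ i j k, mergeEntry a u v i j * mergeEntry a u v i k * mergeEntry a u v j k =
      a i j * a i k * a j k +
      ((if i = u then a j k * ((a u j + a v j - a u j * a v j) * (a u k + a v k - a u k * a v k)
          - a u j * a u k) else 0) - (if i = v then a j k * (a v j * a v k) else 0) +
       ((if j = u then a i k * ((a u i + a v i - a u i * a v i) * (a u k + a v k - a u k * a v k)
          - a u i * a u k) else 0) - (if j = v then a i k * (a v i * a v k) else 0)) +
       ((if k = u then a i j * ((a u i + a v i - a u i * a v i) * (a u j + a v j - a u j * a v j)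
          - a u i * a u j) else 0) - (if k = v then a i j * (a v i * a v j) else 0))) := by
    intro i j k
    have h1 := h.entry
    have h2 := h.entry'
    have h3 := h.ne
    have h3' := h.ne.symm
    have h4 := h.diag
    have h5 := h.symm i u
    have h6 := h.symm i v
    have h7 := h.symm j u
    have h8 := h.symm j v
    by_cases iv : i = v
    · subst iv
      by_cases ju : j = u <;> by_cases jv : j = i <;>
      by_cases ku : k = u <;> by_cases kv : k = i <;>
      (simp_all [mergeEntry]; try ring)
    · by_cases iu : i = u <;> by_cases ju : j = u <;> by_cases jv : j = v <;>
      by_cases ku : k = u <;> by_cases kv : k = v <;>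
      simp_all [mergeEntry] <;> ring
  simp only [hp, Finset.sum_add_distrib, Finset.sum_sub_distrib]
  simp only [Finset.sum_ite_irrel, Finset.sum_const_zero, Finset.sum_ite_eq', Finset.mem_univ,
    if_true]
  simp only [mul_sub, Finset.sum_sub_distrib]
  ring

end MatrixSums


/-! ### Four-cliques and induced four-cycles after adding an edge. -/

section FourCycles

variable {V : Type*} [DecidableEq V]

/-- The adjacency matrix of the complement. -/
def nonEntry (a : V → V → ℚ) (i j : V) : ℚ := 1 - a i j - if i = j then 1 else 0

lemma nonEntry_addEntry {a : V → V → ℚ} {u v : V} (h : IsNonEdge a u v) (i j : V) :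
    nonEntry (addEntry a u v) i j =
      if (i = u ∧ j = v) ∨ (i = v ∧ j = u) then 0 else nonEntry a i j := by
  unfold nonEntry addEntry
  split_ifs with h1 h2
  · rcases h1 with ⟨h3, h4⟩ | ⟨h3, h4⟩
    · exact absurd (h3.symm.trans (h2.trans h4)) h.ne
    · exact absurd (h4.symm.trans (h2.symm.trans h3)) h.ne
  all_goals simp

lemma nonEntry_comm {a : V → V → ℚ} {u v : V} (h : IsNonEdge a u v) (i j : V) :
    nonEntry a i j = nonEntry a j i := by
  simp only [nonEntry, h.symm i j, eq_comm]

variable [Fintype V] {a : V → V → ℚ} {u v : V}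

/-- All six pairs of positions in a four-clique are adjacent, so u and v can be placed in 12 ordered
ways. -/
lemma sum_fourClique_addEntry (h : IsNonEdge a u v) :
    ∑ i, ∑ j, ∑ k, ∑ l, addEntry a u v i j * addEntry a u v i k * addEntry a u v i l *
        addEntry a u v j k * addEntry a u v j l * addEntry a u v k l =
      (∑ i, ∑ j, ∑ k, ∑ l, a i j * a i k * a i l * a j k * a j l * a k l) +
        12 * ∑ j, ∑ k, a j k * (a u j * a v j * (a u k * a v k)) := by
  have hp : ∀ i j k l, addEntry a u v i j * addEntry a u v i k * addEntry a u v i l *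
        addEntry a u v j k * addEntry a u v j l * addEntry a u v k l =
      a i j * a i k * a i l * a j k * a j l * a k l +
      ((if i = u then if j = v then a k l * (a u k * a v k * (a u l * a v l)) else 0 else 0) +
       (if i = v then if j = u then a k l * (a u k * a v k * (a u l * a v l)) else 0 else 0) +
       (if i = u then if k = v then a j l * (a u j * a v j * (a u l * a v l)) else 0 else 0) +
       (if i = v then if k = u then a j l * (a u j * a v j * (a u l * a v l)) else 0 else 0) +
       (if i = u then if l = v then a j k * (a u j * a v j * (a u k * a v k)) else 0 else 0) +
       (if i = v then if l = u then a j k * (a u j * a v j * (a u k * a v k)) else 0 else 0) +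
       (if j = u then if k = v then a i l * (a u i * a v i * (a u l * a v l)) else 0 else 0) +
       (if j = v then if k = u then a i l * (a u i * a v i * (a u l * a v l)) else 0 else 0) +
       (if j = u then if l = v then a i k * (a u i * a v i * (a u k * a v k)) else 0 else 0) +
       (if j = v then if l = u then a i k * (a u i * a v i * (a u k * a v k)) else 0 else 0) +
       (if k = u then if l = v then a i j * (a u i * a v i * (a u j * a v j)) else 0 else 0) +
       (if k = v then if l = u then a i j * (a u i * a v i * (a u j * a v j)) else 0 else 0)) := by
    intro i j k l
    have h1 := h.entry
    have h2 := h.entry'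
    have h3 := h.ne
    have h4 := h.diag
    have siu := h.symm i u
    have siv := h.symm i v
    have sju := h.symm j u
    have sjv := h.symm j v
    have sku := h.symm k u
    have skv := h.symm k v
    have slu := h.symm l u
    have slv := h.symm l v
    rcases eq_or_ne i u with rfl | iu
    · rcases eq_or_ne j v with rfl | jv
      · by_cases ku : k = i <;> by_cases kv : k = j <;> by_cases lu : l = i <;>
          by_cases lv : l = j <;> simp_all [addEntry, mul_comm, mul_left_comm]
      · by_cases ju : j = i <;> by_cases ku : k = i <;> by_cases kv : k = v <;>
          by_cases lu : l = i <;>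
          by_cases lv : l = v <;> simp_all [addEntry, mul_comm, mul_left_comm]
    · rcases eq_or_ne i v with rfl | iv
      · by_cases ju : j = u <;> by_cases jv : j = i <;> by_cases ku : k = u <;>
          by_cases kv : k = i <;> by_cases lu : l = u <;>
          by_cases lv : l = i <;> simp_all [addEntry, mul_comm, mul_left_comm]
      · by_cases ju : j = u <;> by_cases jv : j = v <;> by_cases ku : k = u <;>
          by_cases kv : k = v <;> by_cases lu : l = u <;>
          by_cases lv : l = v <;> simp_all [addEntry, mul_comm, mul_left_comm]
  simp only [hp, Finset.sum_add_distrib]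
  simp only [Finset.sum_ite_irrel, Finset.sum_const_zero, Finset.sum_ite_eq', Finset.mem_univ,
    if_true]
  ring

/-- The new edge can occupy any of the 4 sides in 2 directions, which creates cycles (factor 8). It
can also occupy either of the 2 diagonals in 2 directions, which destroys cycles (factor 4). -/
lemma sum_inducedFourCycle_addEntry (h : IsNonEdge a u v) :
    ∑ i, ∑ j, ∑ k, ∑ l, addEntry a u v i j * addEntry a u v j k * addEntry a u v k l *
        addEntry a u v l i * nonEntry (addEntry a u v) i k * nonEntry (addEntry a u v) j l =
      (∑ i, ∑ j, ∑ k, ∑ l, a i j * a j k * a k l * a l i * nonEntry a i k * nonEntry a j l) +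
        (8 * (∑ j, ∑ k, a j k * (a v j * nonEntry a u j * (a u k * nonEntry a v k))) -
         4 * ∑ j, ∑ k, nonEntry a j k * (a u j * a v j * (a u k * a v k))) := by
  have hp : ∀ i j k l, addEntry a u v i j * addEntry a u v j k * addEntry a u v k l *
        addEntry a u v l i * nonEntry (addEntry a u v) i k * nonEntry (addEntry a u v) j l =
      a i j * a j k * a k l * a l i * nonEntry a i k * nonEntry a j l +
      (((if i = u then if j = v then a k l * (a v k * nonEntry a u k * (a u l * nonEntry a v l))
          else 0 else 0) +
       (if i = v then if j = u then a k l * (a v l * nonEntry a u l * (a u k * nonEntry a v k))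
          else 0 else 0) +
       (if j = u then if k = v then a l i * (a v l * nonEntry a u l * (a u i * nonEntry a v i))
          else 0 else 0) +
       (if j = v then if k = u then a l i * (a v i * nonEntry a u i * (a u l * nonEntry a v l))
          else 0 else 0) +
       (if k = u then if l = v then a i j * (a v i * nonEntry a u i * (a u j * nonEntry a v j))
          else 0 else 0) +
       (if k = v then if l = u then a i j * (a v j * nonEntry a u j * (a u i * nonEntry a v i))
          else 0 else 0) +
       (if l = u then if i = v then a j k * (a v j * nonEntry a u j * (a u k * nonEntry a v k))
          else 0 else 0) +
       (if l = v then if i = u then a j k * (a v k * nonEntry a u k * (a u j * nonEntry a v j))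
          else 0 else 0)) -
       ((if i = u then if k = v then nonEntry a j l * (a u j * a v j * (a u l * a v l))
          else 0 else 0) +
        (if i = v then if k = u then nonEntry a j l * (a u j * a v j * (a u l * a v l))
          else 0 else 0) +
        (if j = u then if l = v then nonEntry a i k * (a u i * a v i * (a u k * a v k))
          else 0 else 0) +
        (if j = v then if l = u then nonEntry a i k * (a u i * a v i * (a u k * a v k))
          else 0 else 0))) := by
    intro i j k l
    have h1 := h.entry
    have h2 := h.entry'
    have h3 := h.ne
    have h4 := h.diag
    have b1 : nonEntry a u v = 1 := by simp [nonEntry, h1, h3]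
    have b2 : nonEntry a v u = 1 := by rw [nonEntry_comm h, b1]
    have b3 : ∀ i, nonEntry a i i = 0 := fun i => by simp [nonEntry, h4]
    have siu := h.symm i u
    have tiu := nonEntry_comm h i u
    have siv := h.symm i v
    have tiv := nonEntry_comm h i v
    have sju := h.symm j u
    have tju := nonEntry_comm h j u
    have sjv := h.symm j v
    have tjv := nonEntry_comm h j v
    have sku := h.symm k u
    have tku := nonEntry_comm h k u
    have skv := h.symm k v
    have tkv := nonEntry_comm h k v
    have slu := h.symm l u
    have tlu := nonEntry_comm h l u
    have slv := h.symm l v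
    have tlv := nonEntry_comm h l v
    simp only [nonEntry_addEntry h]
    clear h
    rcases eq_or_ne i u with rfl | iu
    · rcases eq_or_ne j v with rfl | jv
      · by_cases ku : k = i <;> by_cases kv : k = j <;> by_cases lu : l = i <;>
          by_cases lv : l = j <;> (simp_all [addEntry]; try ring)
      · by_cases ju : j = i <;> by_cases ku : k = i <;> by_cases kv : k = v <;>
          by_cases lu : l = i <;>
          by_cases lv : l = v <;> (simp_all [addEntry]; try ring)
    · rcases eq_or_ne i v with rfl | iv
      · by_cases ju : j = u <;> by_cases jv : j = i <;> by_cases ku : k = u <;>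
          by_cases kv : k = i <;> by_cases lu : l = u <;>
          by_cases lv : l = i <;> (simp_all [addEntry]; try ring)
      · by_cases ju : j = u <;> by_cases jv : j = v <;> by_cases ku : k = u <;>
          by_cases kv : k = v <;> by_cases lu : l = u <;>
          by_cases lv : l = v <;> (simp_all [addEntry]; try ring)
  simp only [hp, Finset.sum_add_distrib, Finset.sum_sub_distrib]
  simp only [Finset.sum_ite_irrel, Finset.sum_const_zero, Finset.sum_ite_eq', Finset.mem_univ,
    if_true]
  have e : ∑ j, ∑ k, a j k * (a v k * nonEntry a u k * (a u j * nonEntry a v j)) =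
      ∑ j, ∑ k, a j k * (a v j * nonEntry a u j * (a u k * nonEntry a v k)) := by
    rw [Finset.sum_comm]
    simp only [h.symm]
  have e' : ∑ j, ∑ k, a k j * (a v j * nonEntry a u j * (a u k * nonEntry a v k)) =
      ∑ j, ∑ k, a j k * (a v j * nonEntry a u j * (a u k * nonEntry a v k)) := by
    simp only [h.symm]
  have e'' : ∑ j, ∑ k, a k j * (a v k * nonEntry a u k * (a u j * nonEntry a v j)) =
      ∑ j, ∑ k, a j k * (a v j * nonEntry a u j * (a u k * nonEntry a v k)) := by
    rw [Finset.sum_comm]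
  simp only [e, e', e'']
  ring

end FourCycles


/-! ### Restraint statistics after merging two vertices. -/

section MergedRestraint

variable {V : Type*}

/-- `|r i ∩ r j|` as a rational number. -/
def pairCard (r : V → Finset ℕ) (i j : V) : ℚ := ((r i ∩ r j).card : ℚ)

/-- `|r i ∩ r j ∩ r k|` as a rational number. -/
def tripleCard (r : V → Finset ℕ) (i j k : V) : ℚ := ((r i ∩ r j ∩ r k).card : ℚ)

/-- `|r i|` as a rational number. -/
def restraintCard (r : V → Finset ℕ) (i : V) : ℚ := ((r i).card : ℚ)

lemma pairCard_comm (r : V → Finset ℕ) (i j : V) : pairCard r i j = pairCard r j i := by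
  rw [pairCard, pairCard, Finset.inter_comm]

lemma tripleCard_swap (r : V → Finset ℕ) (i j k : V) :
    tripleCard r i j k = tripleCard r j i k := by
  rw [tripleCard, tripleCard, Finset.inter_comm (r i)]

lemma tripleCard_swap' (r : V → Finset ℕ) (i j k : V) :
    tripleCard r i j k = tripleCard r i k j := by
  rw [tripleCard, tripleCard, Finset.inter_right_comm]

lemma card_union_rat (A B : Finset ℕ) :
    ((A ∪ B).card : ℚ) = A.card + B.card - (A ∩ B).card := by
  rw [eq_sub_iff_add_eq]
  exact_mod_cast Finset.card_union_add_card_inter A B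

lemma card_union_inter_rat (A B C : Finset ℕ) :
    (((A ∪ B) ∩ C).card : ℚ) = (A ∩ C).card + (B ∩ C).card - (A ∩ B ∩ C).card := by
  rw [Finset.union_inter_distrib_right, card_union_rat, ← Finset.inter_inter_distrib_right]

variable [DecidableEq V]

/-- The restraint obtained by merging `v` into `u`, leaving `v` unrestrained. -/
def mergeRestraint (r : V → Finset ℕ) (u v : V) (i : V) : Finset ℕ :=
  if i = v then ∅ else if i = u then r u ∪ r v else r i

variable [Fintype V] {a : V → V → ℚ} {u v : V}

/-- The vertex v survives with an empty restraint, so `f 0 = 0` is what makes it disappear from the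
sum. The powers `x` and `x ^ 2` are the cases needed for the second symmetric function. -/
lemma sum_apply_card_mergeRestraint (r : V → Finset ℕ) (huv : u ≠ v) (f : ℚ → ℚ) (hf : f 0 = 0) :
    ∑ i, f (restraintCard (mergeRestraint r u v) i) = (∑ i, f (restraintCard r i)) +
      (f (restraintCard r u + restraintCard r v - pairCard r u v)
        - f (restraintCard r u) - f (restraintCard r v)) := by
  have hp : ∀ i, f (restraintCard (mergeRestraint r u v) i) = f (restraintCard r i) +
      ((if i = u then f (restraintCard r u + restraintCard r v - pairCard r u v)
          - f (restraintCard r u) else 0)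
        - if i = v then f (restraintCard r v) else 0) := by
    intro i
    by_cases iv : i = v
    · subst iv
      simp [restraintCard, mergeRestraint, huv.symm, hf]
    · by_cases iu : i = u
      · subst iu
        simp [restraintCard, mergeRestraint, iv, pairCard, card_union_rat]
      · simp [restraintCard, mergeRestraint, iv, iu]
  simp only [hp, Finset.sum_add_distrib, Finset.sum_sub_distrib]
  simp

/-- Common form for counting edges and for summing `pairCard`: `q` is the weight of an edge at the
merged vertex. Only rows and columns u and v change, and symmetry gives the factor 2. -/
lemma sum_mergeEntry (h : IsNonEdge a u v) (w w' : V → V → ℚ) (q : V → ℚ)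
    (hw : ∀ i j, w i j = w j i) (hw' : ∀ i j, w' i j = w' j i)
    (hr : ∀ i j, i ≠ u → i ≠ v → j ≠ u → j ≠ v → w' i j = w i j)
    (hq : ∀ j, j ≠ u → j ≠ v → w' u j = q j) :
    ∑ i, ∑ j, mergeEntry a u v i j * w' i j = (∑ i, ∑ j, a i j * w i j) +
      2 * ∑ k, ((a u k + a v k - a u k * a v k) * q k - a u k * w u k - a v k * w v k) := by
  have hp : ∀ i j, mergeEntry a u v i j * w' i j = a i j * w i j +
      (((if i = u then (a u j + a v j - a u j * a v j) * q j - a u j * w u j else 0)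
        - if i = v then a v j * w v j else 0) +
       ((if j = u then (a u i + a v i - a u i * a v i) * q i - a u i * w u i else 0)
        - if j = v then a v i * w v i else 0)) := by
    intro i j
    have h1 := h.entry
    have h2 := h.entry'
    have h3 := h.ne
    have h3' := h.ne.symm
    have h4 := h.diag
    have h5 := h.symm i u
    have h6 := h.symm i v
    have h7 := hw i u
    have h8 := hw i v
    have h9 := hw' i u
    clear hw hw'
    by_cases iv : i = v
    · subst iv
      by_cases ju : j = u <;> by_cases jv : j = i <;> simp_all [mergeEntry]
    · by_cases iu : i = u <;> by_cases ju : j = u <;> by_cases jv : j = v <;>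
        simp_all [mergeEntry]
  simp only [hp, Finset.sum_add_distrib, Finset.sum_sub_distrib]
  simp only [Finset.sum_ite_irrel, Finset.sum_const_zero, Finset.sum_ite_eq', Finset.mem_univ,
    if_true]
  simp only [Finset.sum_sub_distrib]
  ring

lemma sum_mergeEntry_one (h : IsNonEdge a u v) :
    ∑ i, ∑ j, mergeEntry a u v i j = (∑ i, ∑ j, a i j) - 2 * ∑ k, a u k * a v k := by
  have := sum_mergeEntry h (fun _ _ => 1) (fun _ _ => 1) (fun _ => 1) (by simp) (by simp)
    (by simp) (by simp)
  simp only [mul_one] at this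
  rw [this, sub_eq_add_neg, ← mul_neg, ← Finset.sum_neg_distrib]
  congr 2
  exact Finset.sum_congr rfl fun k _ => by ring

lemma sum_pairCard_mergeRestraint (h : IsNonEdge a u v) (r : V → Finset ℕ) :
    ∑ i, ∑ j, mergeEntry a u v i j * pairCard (mergeRestraint r u v) i j =
      (∑ i, ∑ j, a i j * pairCard r i j) +
      2 * ∑ k, ((a u k + a v k - a u k * a v k) *
        (pairCard r u k + pairCard r v k - tripleCard r u v k)
          - a u k * pairCard r u k - a v k * pairCard r v k) := by
  refine sum_mergeEntry h _ _ _ (pairCard_comm r) (pairCard_comm _) ?_ ?_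
  · intro i j iu iv ju jv
    simp [pairCard, mergeRestraint, iu, iv, ju, jv]
  · intro j ju jv
    simp only [pairCard, tripleCard, mergeRestraint, h.ne, ju, jv, if_true, if_false]
    exact card_union_inter_rat _ _ _

end MergedRestraint

/-! ### Closed forms for the coefficients and their deletion–contraction recursion. -/

section Coefficients

variable {V : Type*} [Fintype V] [DecidableEq V]

/-- The number of edges of a graph with adjacency matrix `a`. -/
def edgeSum (a : V → V → ℚ) : ℚ := 1 / 2 * ∑ i, ∑ j, a i j

/-- The number of triangles of a graph with adjacency matrix `a`. -/
def triangleSum (a : V → V → ℚ) : ℚ := 1 / 6 * ∑ i, ∑ j, ∑ k, a i j * a i k * a j k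

/-- The number of induced four-cycles of a graph with adjacency matrix `a`. -/
def inducedFourCycleSum (a : V → V → ℚ) : ℚ :=
  1 / 8 * ∑ i, ∑ j, ∑ k, ∑ l,
    a i j * a j k * a k l * a l i * nonEntry a i k * nonEntry a j l

/-- The number of four-cliques of a graph with adjacency matrix `a`. -/
def fourCliqueSum (a : V → V → ℚ) : ℚ :=
  1 / 24 * ∑ i, ∑ j, ∑ k, ∑ l, a i j * a i k * a i l * a j k * a j l * a k l

/-- The second elementary symmetric function. -/
def secondSymm (s : V → ℚ) : ℚ := ((∑ i, s i) ^ 2 - ∑ i, s i ^ 2) / 2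

/-- The third elementary symmetric function. -/
def thirdSymm (s : V → ℚ) : ℚ :=
  ((∑ i, s i) ^ 3 - 3 * (∑ i, s i) * (∑ i, s i ^ 2) + 2 * ∑ i, s i ^ 3) / 6

/-- The sum of `|r i ∩ r j|` over the edges. -/
def edgePairSum (a : V → V → ℚ) (r : V → Finset ℕ) : ℚ :=
  1 / 2 * ∑ i, ∑ j, a i j * pairCard r i j

/-- The coefficient `a_{n-1}` of the restrained chromatic polynomial. -/
def coeffOne (a : V → V → ℚ) (r : V → Finset ℕ) : ℚ := (∑ i, restraintCard r i) + edgeSum a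

/-- The coefficient `a_{n-2}` of the restrained chromatic polynomial. -/
def coeffTwo (a : V → V → ℚ) (r : V → Finset ℕ) : ℚ :=
  secondSymm (restraintCard r) + edgeSum a * (∑ i, restraintCard r i) - edgePairSum a r
    + edgeSum a * (edgeSum a - 1) / 2 - triangleSum a

/-- The coefficient `a_{n-3}` of the restrained chromatic polynomial. -/
def coeffThree (a : V → V → ℚ) (r : V → Finset ℕ) : ℚ :=
  (edgeSum a * (edgeSum a - 1) * (edgeSum a - 2) / 6 - (edgeSum a - 2) * triangleSum a
    - inducedFourCycleSum a + 2 * fourCliqueSum a)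
  + thirdSymm (restraintCard r)
  + (edgeSum a - 1) * secondSymm (restraintCard r)
  + (secondSymm (restraintCard r)
      - 1 / 2 * ∑ i, ∑ j, a i j * (restraintCard r i * restraintCard r j))
  - ((∑ i, restraintCard r i) * edgePairSum a r
      - 1 / 2 * ∑ i, ∑ j, a i j * (pairCard r i j * (restraintCard r i + restraintCard r j)))
  + (edgeSum a * (edgeSum a - 1) / 2 - triangleSum a) * (∑ i, restraintCard r i)
  - (edgeSum a - 1) * edgePairSum a r
  + (1 / 2 * (∑ i, ∑ j, ∑ k, a i j * a i k * a j k * pairCard r i j)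
      - 1 / 2 * ∑ i, ∑ j, ∑ k, a i j * a i k * (if j = k then 0 else pairCard r j k))
  + (1 / 2 * (∑ i, ∑ j, ∑ k, a i j * a i k * (if j = k then 0 else tripleCard r i j k))
      - 1 / 6 * ∑ i, ∑ j, ∑ k, a i j * a i k * a j k * tripleCard r i j k)

variable {a : V → V → ℚ} {u v : V}

lemma edgeSum_addEntry (h : IsNonEdge a u v) : edgeSum (addEntry a u v) = edgeSum a + 1 := by
  have := sum_addEntry h (fun _ _ => 1)
  simp only [mul_one] at this
  rw [edgeSum, edgeSum, this]
  ring

lemma triangleSum_addEntry (h : IsNonEdge a u v) :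
    triangleSum (addEntry a u v) = triangleSum a + ∑ k, a u k * a v k := by
  have := sum_triangle_addEntry h (fun _ _ _ => 1)
  simp only [mul_one] at this
  rw [triangleSum, triangleSum, this, ← Finset.sum_mul]
  ring

lemma edgePairSum_addEntry (h : IsNonEdge a u v) (r : V → Finset ℕ) :
    edgePairSum (addEntry a u v) r = edgePairSum a r + pairCard r u v := by
  rw [edgePairSum, edgePairSum, sum_addEntry h, pairCard_comm r v u]
  ring

lemma edgeSum_mergeEntry (h : IsNonEdge a u v) :
    edgeSum (mergeEntry a u v) = edgeSum a - ∑ k, a u k * a v k := by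
  rw [edgeSum, edgeSum, sum_mergeEntry_one h]
  ring

lemma sum_card_mergeRestraint (h : IsNonEdge a u v) (r : V → Finset ℕ) :
    ∑ i, restraintCard (mergeRestraint r u v) i = (∑ i, restraintCard r i) - pairCard r u v := by
  have := sum_apply_card_mergeRestraint r h.ne id rfl
  simp only [id] at this
  rw [this]
  ring

lemma secondSymm_mergeRestraint (h : IsNonEdge a u v) (r : V → Finset ℕ) :
    secondSymm (restraintCard (mergeRestraint r u v)) = secondSymm (restraintCard r)
      - (∑ i, restraintCard r i) * pairCard r u v - restraintCard r u * restraintCard r v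
      + pairCard r u v * (restraintCard r u + restraintCard r v) := by
  rw [secondSymm, secondSymm, sum_card_mergeRestraint h,
    sum_apply_card_mergeRestraint r h.ne (fun x => x ^ 2) (by norm_num)]
  ring

/-- The triangles of the merged graph, in terms of the four-cycles and four-cliques through the
new edge. -/
lemma triangleSum_mergeEntry (h : IsNonEdge a u v) :
    triangleSum (mergeEntry a u v) = triangleSum a +
      (∑ j, ∑ k, a j k * (a v j * nonEntry a u j * (a u k * nonEntry a v k))) -
      1 / 2 * ∑ j, ∑ k, a j k * (a u j * a v j * (a u k * a v k)) := by
  have hb : ∀ j, a v j * nonEntry a u j = a v j * (1 - a u j) := by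
    intro j
    rcases eq_or_ne u j with rfl | hj
    · simp [h.entry']
    · simp [nonEntry, hj]
  have hc : ∀ j, a u j * nonEntry a v j = a u j * (1 - a v j) := by
    intro j
    rcases eq_or_ne v j with rfl | hj
    · simp [h.entry]
    · simp [nonEntry, hj]
  simp only [hb, hc]
  rw [triangleSum, triangleSum, sum_triangle_mergeEntry h]
  have key : ∀ j k, a j k * ((a u j + a v j - a u j * a v j) * (a u k + a v k - a u k * a v k)
          - a u j * a u k - a v j * a v k) =
      a j k * (a v j * (1 - a u j) * (a u k * (1 - a v k))) +
      a j k * (a v k * (1 - a u k) * (a u j * (1 - a v j))) -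
      a j k * (a u j * a v j * (a u k * a v k)) := fun j k => by ring
  have e : ∑ j, ∑ k, a j k * (a v k * (1 - a u k) * (a u j * (1 - a v j))) =
      ∑ j, ∑ k, a j k * (a v j * (1 - a u j) * (a u k * (1 - a v k))) := by
    rw [Finset.sum_comm]
    simp only [h.symm]
  simp only [key, Finset.sum_add_distrib, Finset.sum_sub_distrib, e]
  ring

/-- Ordered pairs of common neighbours, minus the equal pairs, minus the adjacent pairs. -/
lemma sum_nonEntry_common (h : IsNonEdge a u v) :
    ∑ j, ∑ k, nonEntry a j k * (a u j * a v j * (a u k * a v k)) =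
      (∑ k, a u k * a v k) ^ 2 - (∑ k, a u k * a v k)
        - ∑ j, ∑ k, a j k * (a u j * a v j * (a u k * a v k)) := by
  have hd : ∀ k, a u k * a v k * (a u k * a v k) = a u k * a v k := fun k => by
    rw [mul_mul_mul_comm, h.idem, h.idem]
  simp only [nonEntry, sub_mul, one_mul, Finset.sum_sub_distrib, ite_mul, zero_mul,
    Finset.sum_ite_eq, Finset.mem_univ, if_true, hd, sq, Finset.sum_mul_sum]
  ring

lemma coeffOne_addEntry (h : IsNonEdge a u v) (r : V → Finset ℕ) :
    coeffOne (addEntry a u v) r = coeffOne a r + 1 := by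
  rw [coeffOne, coeffOne, edgeSum_addEntry h]
  ring

lemma coeffTwo_addEntry (h : IsNonEdge a u v) (r : V → Finset ℕ) :
    coeffTwo (addEntry a u v) r =
      coeffTwo a r + coeffOne (mergeEntry a u v) (mergeRestraint r u v) := by
  rw [coeffTwo, coeffTwo, coeffOne, edgeSum_addEntry h, triangleSum_addEntry h,
    edgePairSum_addEntry h, edgeSum_mergeEntry h, sum_card_mergeRestraint h]
  ring

/-- The pairs of common neighbours removed in `hC` are balanced by the quadratic term produced when
the number of common neighbours is subtracted from the edge count inside the binomial. The
combination −C₄ + 2K₄ then leaves exactly minus the change in triangles under merging. The remaining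
terms match one restraint statistic at a time. -/
lemma coeffThree_addEntry (h : IsNonEdge a u v) (r : V → Finset ℕ) :
    coeffThree (addEntry a u v) r =
      coeffThree a r + coeffTwo (mergeEntry a u v) (mergeRestraint r u v) := by
  have hC : inducedFourCycleSum (addEntry a u v) = inducedFourCycleSum a +
      (∑ j, ∑ k, a j k * (a v j * nonEntry a u j * (a u k * nonEntry a v k))) -
      1 / 2 * ((∑ k, a u k * a v k) ^ 2 - (∑ k, a u k * a v k)
        - ∑ j, ∑ k, a j k * (a u j * a v j * (a u k * a v k))) := by
    rw [inducedFourCycleSum, inducedFourCycleSum, sum_inducedFourCycle_addEntry h,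
      sum_nonEntry_common h]
    ring
  have hK : fourCliqueSum (addEntry a u v) = fourCliqueSum a +
      1 / 2 * ∑ j, ∑ k, a j k * (a u j * a v j * (a u k * a v k)) := by
    rw [fourCliqueSum, fourCliqueSum, sum_fourClique_addEntry h]
    ring
  have hQ := sum_addEntry h fun i j => restraintCard r i * restraintCard r j
  have hW := sum_addEntry h fun i j => pairCard r i j * (restraintCard r i + restraintCard r j)
  have hT := sum_triangle_addEntry h fun i j _ => pairCard r i j
  have hP := sum_path_addEntry h fun _ j k => if j = k then 0 else pairCard r j k
  have hP' := sum_path_addEntry h fun i j k => if j = k then 0 else tripleCard r i j k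
  have hT' := sum_triangle_addEntry h fun i j k => tripleCard r i j k
  have hP1 : ∑ k, a u k * ((if v = k then 0 else pairCard r v k) +
      (if k = v then 0 else pairCard r k v)) = 2 * ∑ k, a u k * pairCard r v k := by
    rw [Finset.mul_sum]
    refine Finset.sum_congr rfl fun k _ => ?_
    rcases eq_or_ne k v with rfl | hk
    · simp [h.entry]
    · simp only [hk, hk.symm, if_false, pairCard_comm r k v]
      ring
  have hP2 : ∑ k, a v k * ((if u = k then 0 else pairCard r u k) +
      (if k = u then 0 else pairCard r k u)) = 2 * ∑ k, a v k * pairCard r u k := by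
    rw [Finset.mul_sum]
    refine Finset.sum_congr rfl fun k _ => ?_
    rcases eq_or_ne k u with rfl | hk
    · simp [h.entry']
    · simp only [hk, hk.symm, if_false, pairCard_comm r k u]
      ring
  have hP1' : ∑ k, a u k * ((if v = k then 0 else tripleCard r u v k) +
      (if k = v then 0 else tripleCard r u k v)) = 2 * ∑ k, a u k * tripleCard r u v k := by
    rw [Finset.mul_sum]
    refine Finset.sum_congr rfl fun k _ => ?_
    rcases eq_or_ne k v with rfl | hk
    · simp [h.entry]
    · simp only [hk, hk.symm, if_false, tripleCard_swap' r u k v]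
      ring
  have hP2' : ∑ k, a v k * ((if u = k then 0 else tripleCard r v u k) +
      (if k = u then 0 else tripleCard r v k u)) = 2 * ∑ k, a v k * tripleCard r u v k := by
    rw [Finset.mul_sum]
    refine Finset.sum_congr rfl fun k _ => ?_
    rcases eq_or_ne k u with rfl | hk
    · simp [h.entry']
    · simp only [hk, hk.symm, if_false, tripleCard_swap' r v k u, tripleCard_swap r v u k]
      ring
  have hT1 : ∑ k, a u k * a v k * (pairCard r u v + pairCard r v u + pairCard r u k
      + pairCard r v k + pairCard r k u + pairCard r k v) =
      2 * pairCard r u v * (∑ k, a u k * a v k) + 2 * (∑ k, a u k * a v k * pairCard r u k)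
        + 2 * ∑ k, a u k * a v k * pairCard r v k := by
    simp only [Finset.mul_sum, ← Finset.sum_add_distrib]
    refine Finset.sum_congr rfl fun k _ => ?_
    rw [pairCard_comm r v u, pairCard_comm r k u, pairCard_comm r k v]
    ring
  have hT1' : ∑ k, a u k * a v k * (tripleCard r u v k + tripleCard r v u k + tripleCard r u k v
      + tripleCard r v k u + tripleCard r k u v + tripleCard r k v u) =
      6 * ∑ k, a u k * a v k * tripleCard r u v k := by
    rw [Finset.mul_sum]
    refine Finset.sum_congr rfl fun k _ => ?_
    rw [tripleCard_swap r k u v, tripleCard_swap r k v u, tripleCard_swap' r v k u,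
      tripleCard_swap' r u k v, tripleCard_swap r v u k]
    ring
  have hM : edgePairSum (mergeEntry a u v) (mergeRestraint r u v) = edgePairSum a r
      + (∑ k, a v k * pairCard r u k) + (∑ k, a u k * pairCard r v k)
      - (∑ k, a u k * a v k * pairCard r u k) - (∑ k, a u k * a v k * pairCard r v k)
      - (∑ k, a u k * tripleCard r u v k) - (∑ k, a v k * tripleCard r u v k)
      + ∑ k, a u k * a v k * tripleCard r u v k := by
    rw [edgePairSum, edgePairSum, sum_pairCard_mergeRestraint h, mul_add, ← mul_assoc]
    norm_num
    simp only [add_assoc, sub_eq_add_neg, ← Finset.sum_neg_distrib, ← Finset.sum_add_distrib]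
    congr 1
    refine Finset.sum_congr rfl fun k _ => ?_
    ring
  -- Here `if_true` kills the doubled-leg corrections, whose weights sit at j = k.
  simp only [hP1, hP2, hP1', hP2', hT1, hT1', if_true] at hT hP hP' hT'
  rw [coeffThree, coeffThree, coeffTwo, edgeSum_addEntry h, triangleSum_addEntry h,
    edgePairSum_addEntry h, edgeSum_mergeEntry h, sum_card_mergeRestraint h,
    secondSymm_mergeRestraint h, triangleSum_mergeEntry h, hC, hK, hM, hQ, hW, hT, hP, hP', hT',
    pairCard_comm r v u]
  ring

end Coefficients


open Polynomial

/-! ### Newton's identities up to degree three. -/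

section SymmetricFunctions

lemma esymm_cons {R : Type*} [CommSemiring R] (x : R) (t : Multiset R) (k : ℕ) :
    (x ::ₘ t).esymm (k + 1) = t.esymm (k + 1) + x * t.esymm k := by
  simp [Multiset.esymm, Multiset.powersetCard_cons, Multiset.sum_map_mul_left]

lemma esymm_low_degree (t : Multiset ℤ) :
    t.esymm 0 = 1 ∧ t.esymm 1 = t.sum ∧ 2 * t.esymm 2 = t.sum ^ 2 - (t.map (· ^ 2)).sum ∧
      6 * t.esymm 3 = t.sum ^ 3 - 3 * t.sum * (t.map (· ^ 2)).sum
        + 2 * (t.map (· ^ 3)).sum := by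
  induction t using Multiset.induction with
  | empty => simp [Multiset.esymm, Multiset.powersetCard_zero_right]
  | cons x t ih =>
    obtain ⟨h0, h1, h2, h3⟩ := ih
    have e1 := esymm_cons x t 0
    have e2 := esymm_cons x t 1
    have e3 := esymm_cons x t 2
    norm_num at e1 e2 e3
    refine ⟨by simp [Multiset.esymm], ?_, ?_, ?_⟩
    · rw [e1, h0, h1]; simp [add_comm]
    · rw [e2, h1, mul_add, h2]
      simp only [Multiset.sum_cons, Multiset.map_cons]
      ring
    · rw [e3, mul_add, h3]
      simp only [Multiset.sum_cons, Multiset.map_cons]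
      linear_combination 3 * x * h2

end SymmetricFunctions

/-! ### Edge deletion and vertex merging on adjacency matrices. -/

section Graphs

variable {V : Type*}

open Classical in
/-- The rational adjacency matrix of `G`. -/
noncomputable def adjEntry (G : SimpleGraph V) (i j : V) : ℚ := if G.Adj i j then 1 else 0

lemma adjEntry_congr {G H : SimpleGraph V} {i j k l : V} (h : G.Adj i j ↔ H.Adj k l) :
    adjEntry G i j = adjEntry H k l := by
  by_cases h1 : H.Adj k l
  · rw [adjEntry, adjEntry, if_pos h1, if_pos (h.2 h1)]
  · rw [adjEntry, adjEntry, if_neg h1, if_neg (mt h.1 h1)]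

/-- The graph obtained by merging `v` into `u`, leaving `v` isolated. -/
def mergeGraph (G : SimpleGraph V) (u v : V) : SimpleGraph V where
  Adj i j := i ≠ v ∧ j ≠ v ∧ i ≠ j ∧
    (G.Adj i j ∨ (i = u ∧ G.Adj v j) ∨ (j = u ∧ G.Adj v i))
  symm := ⟨fun i j h => ⟨h.2.1, h.1, h.2.2.1.symm, by
    rcases h.2.2.2 with h | h | h
    · exact Or.inl h.symm
    · exact Or.inr (Or.inr h)
    · exact Or.inr (Or.inl h)⟩⟩
  loopless := ⟨fun _ h => h.2.2.1 rfl⟩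

lemma isNonEdge_adjEntry (G : SimpleGraph V) {u v : V} (huv : u ≠ v) (h : ¬ G.Adj u v) :
    IsNonEdge (adjEntry G) u v where
  symm i j := adjEntry_congr (G.adj_comm i j)
  diag i := by simp [adjEntry]
  idem i j := by simp [adjEntry]
  ne := huv
  entry := by simp [adjEntry, h]

variable [DecidableEq V]

lemma adjEntry_eq_addEntry (G : SimpleGraph V) {u v : V} (h : G.Adj u v) :
    adjEntry G = addEntry (adjEntry (G.deleteEdges {s(u, v)})) u v := by
  ext i j
  unfold addEntry
  by_cases hij : (i = u ∧ j = v) ∨ (i = v ∧ j = u)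
  · rcases hij with ⟨rfl, rfl⟩ | ⟨rfl, rfl⟩
    · simp [adjEntry, h]
    · simp [adjEntry, h.symm]
  · rw [if_neg hij]
    refine adjEntry_congr ?_
    rw [SimpleGraph.deleteEdges_adj, Set.mem_singleton_iff, Sym2.eq_iff]
    exact (and_iff_left hij).symm

lemma adjEntry_mergeGraph (G : SimpleGraph V) {u v : V} (huv : u ≠ v) (h : ¬ G.Adj u v) :
    adjEntry (mergeGraph G u v) = mergeEntry (adjEntry G) u v := by
  ext i j
  have hvu : ¬ G.Adj v u := fun h' => h h'.symm
  unfold mergeEntry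
  by_cases iv : i = v
  · simp [adjEntry, mergeGraph, iv]
  by_cases jv : j = v
  · simp [adjEntry, mergeGraph, jv]
  rw [if_neg (by simp [iv, jv])]
  by_cases iu : i = u
  · subst iu
    by_cases ij : i = j
    · subst ij
      simp [adjEntry, mergeGraph, hvu]
    · by_cases h1 : G.Adj i j <;> by_cases h2 : G.Adj v j <;>
        simp [adjEntry, mergeGraph, iv, jv, ij, h1, h2, hvu]
  · by_cases ju : j = u
    · subst ju
      by_cases h1 : G.Adj j i <;> by_cases h2 : G.Adj v i <;>
        simp [adjEntry, mergeGraph, iv, jv, iu, h1, h2, G.adj_comm i j]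
    · rw [if_neg iu, if_neg ju]
      refine adjEntry_congr ⟨fun h' => ?_, fun h' => ⟨iv, jv, h'.ne, Or.inl h'⟩⟩
      rcases h'.2.2.2 with h' | h' | h'
      exacts [h', absurd h'.1 iu, absurd h'.1 ju]

end Graphs

/-! ### Deletion–contraction for colourings and the resulting polynomial. -/

section Counting

variable {V : Type*} [Fintype V] [DecidableEq V]

open Classical in
/-- `permittedColourings` with classical decidability. -/
noncomputable def colourings (G : SimpleGraph V) (r : V → Finset ℕ) (x : ℕ) :
    Finset (V → ℕ) := permittedColourings G r x

lemma restrainedCount_eq (G : SimpleGraph V) [DecidableRel G.Adj] (r : V → Finset ℕ) (x : ℕ) :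
    restrainedCount G r x = (colourings G r x).card := by
  rw [restrainedCount, colourings]
  congr!

lemma mem_colourings {G : SimpleGraph V} {r : V → Finset ℕ} {x : ℕ} {c : V → ℕ} :
    c ∈ colourings G r x ↔
      (∀ v, c v ∈ Finset.Icc 1 x) ∧ (∀ u v, G.Adj u v → c u ≠ c v) ∧ ∀ v, c v ∉ r v := by
  simp only [colourings, permittedColourings, Finset.mem_filter, Fintype.mem_piFinset]

lemma card_colourings_deleteEdges (G : SimpleGraph V) {u v : V} (h : G.Adj u v)
    (r : V → Finset ℕ) (x : ℕ) :
    (colourings (G.deleteEdges {s(u, v)}) r x).card = (colourings G r x).card +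
      ((colourings (G.deleteEdges {s(u, v)}) r x).filter fun c => c u = c v).card := by
  rw [← Finset.card_filter_add_card_filter_not (s := colourings (G.deleteEdges {s(u, v)}) r x)
    (fun c => c u = c v), add_comm]
  congr 2
  ext c
  simp only [Finset.mem_filter, mem_colourings, SimpleGraph.deleteEdges_adj,
    Set.mem_singleton_iff, Sym2.eq_iff]
  constructor
  · rintro ⟨⟨h1, h2, h3⟩, h4⟩
    refine ⟨h1, fun i j hij => ?_, h3⟩
    by_cases he : (i = u ∧ j = v) ∨ (i = v ∧ j = u)
    · rcases he with ⟨rfl, rfl⟩ | ⟨rfl, rfl⟩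
      · exact h4
      · exact fun h' => h4 h'.symm
    · exact h2 i j ⟨hij, he⟩
  · rintro ⟨h1, h2, h3⟩
    exact ⟨⟨h1, fun i j hij => h2 i j hij.1, h3⟩, h2 u v h⟩

/-- The colour of the isolated vertex v is arbitrary, which is the factor x. Overwriting it with the
colour of u recovers a colouring of G with c(u) = c(v). -/
lemma card_colourings_mergeGraph (G : SimpleGraph V) {u v : V} (huv : u ≠ v)
    (h : ¬ G.Adj u v) (r : V → Finset ℕ) (x : ℕ) :
    (colourings (mergeGraph G u v) (mergeRestraint r u v) x).card =
      x * ((colourings G r x).filter fun c => c u = c v).card := by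
  have hx : x = (Finset.Icc 1 x).card := by simp
  conv_rhs => rw [hx]
  rw [← Finset.card_product]
  have hvu : ¬ G.Adj v u := fun h' => h h'.symm
  refine Finset.card_nbij' (fun c => (c v, Function.update c v (c u)))
    (fun p => Function.update p.2 v p.1) ?_ ?_ ?_ ?_
  · intro c hc
    obtain ⟨h1, h2, h3⟩ := mem_colourings.1 hc
    have hu := h3 u
    simp only [mergeRestraint, huv, if_true, if_false, Finset.mem_union, not_or] at hu
    simp only [Finset.coe_product, Set.mem_prod, Finset.mem_coe, Finset.mem_filter,
      mem_colourings]
    refine ⟨h1 v, ⟨fun w => ?_, fun i j hij => ?_, fun w => ?_⟩, ?_⟩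
    · by_cases hw : w = v
      · subst hw; simpa using h1 u
      · simpa [hw] using h1 w
    · by_cases iv : i = v
      · subst iv
        have hj : j ≠ i := hij.ne'
        have hju : j ≠ u := by rintro rfl; exact hvu hij
        simpa [hj] using h2 u j ⟨huv, hj, hju.symm, Or.inr (Or.inl ⟨rfl, hij⟩)⟩
      · by_cases jv : j = v
        · subst jv
          have hiu : i ≠ u := by rintro rfl; exact h hij
          simpa [iv] using h2 i u ⟨iv, huv, hiu, Or.inr (Or.inr ⟨rfl, hij.symm⟩)⟩
        · simpa [iv, jv] using h2 i j ⟨iv, jv, hij.ne, Or.inl hij⟩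
    · by_cases hw : w = v
      · subst hw; simpa using hu.2
      · by_cases hwu : w = u
        · subst hwu; simpa [hw] using hu.1
        · simpa [hw, hwu, mergeRestraint] using h3 w
    · simp [huv]
  · rintro ⟨y, c⟩ hc
    simp only [Finset.coe_product, Set.mem_prod, Finset.mem_coe, Finset.mem_filter,
      mem_colourings] at hc
    obtain ⟨hy, ⟨h1, h2, h3⟩, h4⟩ := hc
    simp only [Finset.mem_coe, mem_colourings]
    refine ⟨fun w => ?_, fun i j hij => ?_, fun w => ?_⟩
    · by_cases hw : w = v
      · subst hw; simpa using hy
      · simpa [hw] using h1 w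
    · obtain ⟨iv, jv, -, hij⟩ := hij
      simp only [ne_eq, iv, not_false_eq_true, Function.update_of_ne, jv]
      rcases hij with hij | ⟨rfl, hij⟩ | ⟨rfl, hij⟩
      · exact h2 i j hij
      · rw [h4]; exact h2 v j hij
      · rw [h4]; exact fun h' => h2 v i hij h'.symm
    · by_cases hw : w = v
      · simp [mergeRestraint, hw]
      · by_cases hwu : w = u
        · subst hwu
          have := h3 v
          rw [← h4] at this
          simp [mergeRestraint, hw, h3 w, this]
        · simpa [mergeRestraint, hw, hwu] using h3 w
  · intro c _
    simp
  · rintro ⟨y, c⟩ hc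
    simp only [Finset.coe_product, Set.mem_prod, Finset.mem_coe, Finset.mem_filter] at hc
    have h4 := hc.2.2
    simp [huv, h4]

lemma card_colourings_bot {r : V → Finset ℕ} {x : ℕ} (hr : ∀ v, r v ⊆ Finset.Icc 1 x) :
    ((colourings ⊥ r x).card : ℤ) = ∏ v, ((x : ℤ) - ((r v).card : ℤ)) := by
  have h : colourings ⊥ r x = Fintype.piFinset fun v => Finset.Icc 1 x \ r v := by
    ext c
    simp [mem_colourings, Fintype.mem_piFinset, forall_and]
  rw [h, Fintype.card_piFinset, Nat.cast_prod]
  refine Finset.prod_congr rfl fun v _ => ?_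
  rw [Finset.card_sdiff_of_subset (hr v), Nat.cast_sub (Finset.card_le_card (hr v))]
  simp

/-- Modulo x the value at x is the constant term, so that term is divisible by every large x. -/
lemma coeff_zero_eq_zero_of_dvd_eval {P : ℤ[X]} {K : ℕ}
    (h : ∀ x : ℕ, K ≤ x → (x : ℤ) ∣ P.eval (x : ℤ)) : P.coeff 0 = 0 := by
  have hd : ∀ x : ℕ, K ≤ x → (x : ℤ) ∣ P.coeff 0 := by
    intro x hx
    have h1 := h x hx
    rw [← P.divX_mul_X_add, eval_add, eval_mul, eval_X, eval_C] at h1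
    exact (Int.dvd_add_right (dvd_mul_left _ _)).1 h1
  refine Int.eq_zero_of_abs_lt_dvd (hd (K + (P.coeff 0).natAbs + 1) (by omega)) ?_
  rw [Int.abs_eq_natAbs]
  push_cast
  omega

/-- `P` has degree at most `n = |V|`, and its four leading coefficients are the expected ones. -/
structure HasLeadingCoeffs (P : ℤ[X]) (a : V → V → ℚ) (r : V → Finset ℕ) : Prop where
  natDegree_le : P.natDegree ≤ Fintype.card V
  coeff_zero : P.coeff (Fintype.card V) = 1
  coeff_one : (P.coeff (Fintype.card V - 1) : ℚ) = -coeffOne a r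
  coeff_two : (P.coeff (Fintype.card V - 2) : ℚ) = coeffTwo a r
  coeff_three : (P.coeff (Fintype.card V - 3) : ℚ) = -coeffThree a r

lemma hasLeadingCoeffs_bot (hn : 3 ≤ Fintype.card V) (r : V → Finset ℕ) :
    HasLeadingCoeffs (∏ v, (X - C ((r v).card : ℤ))) (adjEntry ⊥) r := by
  set t : Multiset ℤ := Finset.univ.val.map fun v => ((r v).card : ℤ) with ht
  have hP : (∏ v, (X - C ((r v).card : ℤ))) = (t.map fun x => X - C x).prod := by
    rw [ht, Multiset.map_map]; rfl
  have hcard : Multiset.card t = Fintype.card V := by rw [ht, Multiset.card_map]; rfl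
  obtain ⟨h0, h1, h2, h3⟩ := esymm_low_degree t
  have hs : ∀ f : ℤ → ℤ, (t.map f).sum = ∑ v, f (r v).card := by
    intro f; rw [ht, Multiset.map_map]; rfl
  have hs1 : t.sum = ∑ v, ((r v).card : ℤ) := rfl
  have hc : ∀ k ≤ 3, (∏ v, (X - C ((r v).card : ℤ))).coeff (Fintype.card V - k) =
      (-1) ^ k * t.esymm k := by
    intro k hk
    rw [hP, Multiset.prod_X_sub_C_coeff t (by omega), hcard,
      Nat.sub_sub_self (hk.trans hn)]
  rw [hs1, hs] at h2 h3
  rw [hs] at h3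
  have h2' : (2 : ℚ) * (t.esymm 2 : ℤ) =
      (∑ v, ((r v).card : ℚ)) ^ 2 - ∑ v, ((r v).card : ℚ) ^ 2 := by
    exact_mod_cast h2
  have h3' : (6 : ℚ) * (t.esymm 3 : ℤ) = (∑ v, ((r v).card : ℚ)) ^ 3
      - 3 * (∑ v, ((r v).card : ℚ)) * (∑ v, ((r v).card : ℚ) ^ 2)
      + 2 * ∑ v, ((r v).card : ℚ) ^ 3 := by
    exact_mod_cast h3
  have ha : adjEntry (⊥ : SimpleGraph V) = fun _ _ => 0 := by
    ext i j; simp [adjEntry]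
  refine ⟨?_, ?_, ?_, ?_, ?_⟩
  · rw [natDegree_prod_of_monic _ _ fun v _ => monic_X_sub_C _]
    simp only [natDegree_X_sub_C, Finset.sum_const, Finset.card_univ, smul_eq_mul, mul_one, le_refl]
  · simpa [h0] using hc 0 (by norm_num)
  · rw [hc 1 (by norm_num), h1, hs1, ha]
    simp [coeffOne, edgeSum, restraintCard]
  · rw [hc 2 (by norm_num), ha]
    simp [coeffTwo, edgeSum, restraintCard, edgePairSum, triangleSum, secondSymm]
    linear_combination h2' / 2
  · rw [hc 3 (by norm_num), ha]
    simp [coeffThree, edgeSum, restraintCard, edgePairSum, triangleSum, secondSymm, thirdSymm,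
      inducedFourCycleSum, fourCliqueSum]
    linear_combination h3' / 6

/-- The induction is on a strict bound for the number of edges, since merging can lose several edges
at once. A fixed `M` works throughout because a union of subsets of {1, …, M} is again one; `1 ≤ M`
allows cancelling x. -/
theorem exists_polynomial (hn : 3 ≤ Fintype.card V) (M : ℕ) (hM : 1 ≤ M) (k : ℕ) :
    ∀ G : SimpleGraph V, edgeSum (adjEntry G) < k → ∀ r : V → Finset ℕ,
      (∀ v, r v ⊆ Finset.Icc 1 M) →
      ∃ P : ℤ[X], HasLeadingCoeffs P (adjEntry G) r ∧
        ∀ x : ℕ, M ≤ x → ((colourings G r x).card : ℤ) = P.eval (x : ℤ) := by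
  induction k with
  | zero =>
    intro G hG
    refine absurd hG (not_lt.2 ?_)
    rw [edgeSum, Nat.cast_zero]
    refine mul_nonneg (by norm_num) (Finset.sum_nonneg fun i _ => Finset.sum_nonneg fun j _ => ?_)
    rw [adjEntry]
    split_ifs <;> norm_num
  | succ k ih =>
    intro G hG r hr
    by_cases hbot : G = ⊥
    · subst hbot
      refine ⟨_, hasLeadingCoeffs_bot hn r, fun x hx => ?_⟩
      rw [card_colourings_bot fun v => (hr v).trans (Finset.Icc_subset_Icc_right hx), eval_prod]
      simp
    obtain ⟨u, v, huv⟩ := SimpleGraph.ne_bot_iff_exists_adj.1 hbot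
    set G₀ := G.deleteEdges {s(u, v)} with hG₀
    have hne : u ≠ v := huv.ne
    have h0 : ¬ G₀.Adj u v := by simp [hG₀]
    have hN := isNonEdge_adjEntry G₀ hne h0
    have hadd := adjEntry_eq_addEntry G huv
    have hmerge := adjEntry_mergeGraph G₀ hne h0
    have hk : edgeSum (adjEntry G₀) < k := by
      rw [hadd, edgeSum_addEntry hN] at hG
      push_cast at hG
      linarith
    have hk' : edgeSum (adjEntry (mergeGraph G₀ u v)) < k := by
      rw [hmerge, edgeSum_mergeEntry hN]
      refine lt_of_le_of_lt (sub_le_self _ (Finset.sum_nonneg fun i _ => ?_)) hk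
      simp only [adjEntry]
      split_ifs <;> norm_num
    obtain ⟨P, hP, hPx⟩ := ih G₀ hk r hr
    obtain ⟨P', hP', hPx'⟩ := ih (mergeGraph G₀ u v) hk' (mergeRestraint r u v) (by
      intro w
      rw [mergeRestraint]
      split_ifs
      · exact Finset.empty_subset _
      · exact Finset.union_subset (hr u) (hr v)
      · exact hr w)
    have hzero : P'.coeff 0 = 0 := by
      refine coeff_zero_eq_zero_of_dvd_eval (K := M) fun x hx => ?_
      rw [← hPx' x hx, card_colourings_mergeGraph G₀ hne h0]
      exact_mod_cast dvd_mul_right _ _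
    have hX : P'.divX * X = P' := by
      conv_rhs => rw [← P'.divX_mul_X_add, hzero, C_0, add_zero]
    -- Division by X shifts degrees by one, so the coefficient of degree n − k in `P'.divX` is the
    -- one of degree n − k + 1 in P'.
    refine ⟨P - P'.divX, ⟨?_, ?_, ?_, ?_, ?_⟩, fun x hx => ?_⟩
    · refine (natDegree_sub_le _ _).trans (max_le hP.natDegree_le ?_)
      rw [natDegree_divX_eq_natDegree_tsub_one]
      exact (Nat.sub_le _ _).trans hP'.natDegree_le
    · rw [coeff_sub, coeff_divX, hP.coeff_zero,
        coeff_eq_zero_of_natDegree_lt (Nat.lt_succ_of_le hP'.natDegree_le), sub_zero]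
    · rw [coeff_sub, coeff_divX, Nat.sub_add_cancel (by omega), hP'.coeff_zero, Int.cast_sub,
        hP.coeff_one, hadd, coeffOne_addEntry hN]
      push_cast
      ring
    · rw [coeff_sub, coeff_divX, show Fintype.card V - 2 + 1 = Fintype.card V - 1 by omega,
        Int.cast_sub, hP.coeff_two, hP'.coeff_one, hadd, coeffTwo_addEntry hN, hmerge]
      ring
    · rw [coeff_sub, coeff_divX, show Fintype.card V - 3 + 1 = Fintype.card V - 2 by omega,
        Int.cast_sub, hP.coeff_three, hP'.coeff_two, hadd, coeffThree_addEntry hN, hmerge]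
      ring
    · have h1 := card_colourings_deleteEdges G huv r x
      have h2 := hPx' x hx
      rw [card_colourings_mergeGraph G₀ hne h0, ← hX, eval_mul, eval_X, Nat.cast_mul,
        mul_comm] at h2
      have hx0 : (x : ℤ) ≠ 0 := by
        have : x ≠ 0 := by omega
        exact_mod_cast this
      have h3 := mul_right_cancel₀ hx0 h2
      rw [eval_sub, ← hPx x hx, ← h3, hG₀, h1]
      push_cast
      ring

end Counting


/-! ### Subgraph counts as sums over tuples of vertices. -/

section Embeddings

variable {V W : Type*}

/-- Sort embeddings by their image S. Once an isomorphism from the induced graph on S to H is fixed,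
the embeddings with image S correspond to automorphisms of H. -/
lemma card_embedding_eq [Finite V] [Finite W] (G : SimpleGraph V) (H : SimpleGraph W) :
    Nat.card (H ↪g G) = inducedCount G H * Nat.card (H ≃g H) := by
  classical
  have := Fintype.ofFinite V
  have := Fintype.ofFinite W
  have hmem : ∀ f : H ↪g G, Set.range f ∈ {S : Set V | Nonempty (G.induce S ≃g H)} := fun f =>
    ⟨(RelIso.mk (Equiv.ofInjective f f.injective) fun {a b} => f.map_rel_iff).symm⟩
  let φ : (H ↪g G) → {S : Set V | Nonempty (G.induce S ≃g H)} := fun f => ⟨Set.range f, hmem f⟩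
  have hfib : ∀ S, Nat.card {f : H ↪g G // φ f = S} = Nat.card (H ≃g H) := by
    rintro ⟨S, ⟨e⟩⟩
    refine (Nat.card_congr (Equiv.ofBijective (fun σ : H ≃g H =>
      (⟨((σ.trans e.symm).toRelEmbedding.trans (SimpleGraph.Embedding.induce S)), ?_⟩ :
        {f : H ↪g G // φ f = ⟨S, ⟨e⟩⟩})) ⟨?_, ?_⟩)).symm
    · refine Subtype.ext (Set.ext fun x => ⟨?_, fun hx => ?_⟩)
      · rintro ⟨w, rfl⟩
        exact (e.symm (σ w)).2
      · refine ⟨σ.symm (e ⟨x, hx⟩), ?_⟩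
        change ((e.symm (σ (σ.symm (e ⟨x, hx⟩)))) : V) = x
        simp
    · intro σ τ hστ
      ext w
      have h1 := DFunLike.congr_fun (Subtype.ext_iff.1 hστ) w
      change ((e.symm (σ w)) : V) = e.symm (τ w) at h1
      exact e.symm.injective (Subtype.ext h1)
    · rintro ⟨f, hf⟩
      have hS : Set.range f = S := congrArg Subtype.val hf
      subst hS
      refine ⟨(RelIso.mk (Equiv.ofInjective f f.injective) fun {a b} => f.map_rel_iff).trans e, ?_⟩
      refine Subtype.ext (RelEmbedding.ext fun w => ?_)
      change ((e.symm (e ⟨f w, _⟩)) : V) = f w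
      simp
  rw [Nat.card_congr (Equiv.sigmaFiberEquiv φ).symm, Nat.card_sigma]
  simp only [hfib, Finset.sum_const, smul_eq_mul, Finset.card_univ]
  rw [inducedCount, ← Nat.card_coe_set_eq, Nat.card_eq_fintype_card (α := Set.Elem _)]

/-- A complete subgraph is determined by its vertex set and is induced, so `card_embedding_eq` also
applies to triangles and four-cliques. -/
lemma copyCount_completeGraph [Fintype V] (G : SimpleGraph V) (n : ℕ) :
    G.copyCount (⊤ : SimpleGraph (Fin n)) = inducedCount G (⊤ : SimpleGraph (Fin n)) := by
  classical
  have hadj : ∀ G' : G.Subgraph, Nonempty ((⊤ : SimpleGraph (Fin n)) ≃g G'.coe) → ∀ x y,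
      G'.Adj x y ↔ x ∈ G'.verts ∧ y ∈ G'.verts ∧ x ≠ y := by
    rintro G' ⟨e⟩ x y
    refine ⟨fun h => ⟨h.fst_mem, h.snd_mem, h.ne⟩, ?_⟩
    rintro ⟨hx, hy, hxy⟩
    have h1 : (⊤ : SimpleGraph (Fin n)).Adj (e.symm ⟨x, hx⟩) (e.symm ⟨y, hy⟩) := by
      rw [SimpleGraph.top_adj]
      exact fun h => hxy (congrArg Subtype.val (e.symm.injective h))
    exact e.symm.map_rel_iff.1 h1
  rw [SimpleGraph.copyCount, inducedCount, ← Set.ncard_coe_finset]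
  refine Set.ncard_congr (fun G' _ => G'.verts) ?_ ?_ ?_
  · intro G' hG'
    have h := hadj G' (by simpa using hG')
    obtain ⟨e⟩ : Nonempty ((⊤ : SimpleGraph (Fin n)) ≃g G'.coe) := by simpa using hG'
    refine ⟨RelIso.mk e.symm.toEquiv fun {x y} => ?_⟩
    rw [show (⊤ : SimpleGraph (Fin n)).Adj (e.symm.toEquiv x) (e.symm.toEquiv y) ↔ G'.coe.Adj x y
      from e.symm.map_rel_iff]
    refine ⟨fun h' => h'.adj_sub, fun h' => (h _ _).2 ⟨x.2, y.2, ?_⟩⟩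
    exact SimpleGraph.Adj.ne (G := G) h'
  · intro G₁ G₂ h₁ h₂ hv
    refine SimpleGraph.Subgraph.ext hv ?_
    ext x y
    rw [hadj G₁ (by simpa using h₁), hadj G₂ (by simpa using h₂), hv]
  · rintro S ⟨e⟩
    refine ⟨(⊤ : G.Subgraph).induce S, ?_, rfl⟩
    simp only [Finset.coe_filter, Finset.mem_univ, true_and, Set.mem_ofPred_eq]
    refine ⟨RelIso.mk e.symm.toEquiv fun {x y} => ?_⟩
    rw [← e.symm.map_rel_iff]
    exact ⟨fun h => h.2.2, fun h => ⟨(e.symm x).2, (e.symm y).2, h⟩⟩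

/-- Graph isomorphisms as adjacency-preserving permutations. -/
def isoEquivSubtype (H : SimpleGraph W) :
    (H ≃g H) ≃ {σ : Equiv.Perm W // ∀ a b, H.Adj (σ a) (σ b) ↔ H.Adj a b} where
  toFun e := ⟨e.toEquiv, fun _ _ => e.map_rel_iff⟩
  invFun σ := ⟨σ.1, fun {a b} => σ.2 a b⟩
  left_inv _ := rfl
  right_inv _ := rfl

lemma card_iso_top (n : ℕ) :
    Nat.card ((⊤ : SimpleGraph (Fin n)) ≃g (⊤ : SimpleGraph (Fin n))) = n.factorial := by
  rw [Nat.card_congr (isoEquivSubtype _), Nat.card_congr (Equiv.subtypeUnivEquiv fun σ a b => by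
    simp), Nat.card_eq_fintype_card, Fintype.card_perm, Fintype.card_fin]

lemma card_iso_cycleGraph_four :
    Nat.card (SimpleGraph.cycleGraph 4 ≃g SimpleGraph.cycleGraph 4) = 8 := by
  rw [Nat.card_congr (isoEquivSubtype _), Nat.card_eq_fintype_card]
  decide +kernel

/-- Graph embeddings as injective maps preserving and reflecting adjacency. -/
def embeddingEquivSubtype (G : SimpleGraph V) (H : SimpleGraph W) :
    (H ↪g G) ≃ {f : W → V // Function.Injective f ∧ ∀ a b, G.Adj (f a) (f b) ↔ H.Adj a b} where
  toFun e := ⟨e, e.injective, fun _ _ => e.map_rel_iff⟩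
  invFun f := ⟨⟨f.1, f.2.1⟩, fun {a b} => f.2.2 a b⟩
  left_inv _ := rfl
  right_inv _ := rfl

lemma sum_fin_succ_fun [Fintype V] (n : ℕ) (F : (Fin (n + 1) → V) → ℚ) :
    ∑ f, F f = ∑ x, ∑ g : Fin n → V, F (Matrix.vecCons x g) := by
  rw [← (Fin.consEquiv fun _ => V).sum_comp, Fintype.sum_prod_type]
  rfl

lemma sum_fin_three_fun [Fintype V] (F : (Fin 3 → V) → ℚ) :
    ∑ f, F f = ∑ i, ∑ j, ∑ k, F ![i, j, k] := by
  simp only [sum_fin_succ_fun, Fintype.sum_unique, Subsingleton.elim default (![] : Fin 0 → V)]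

lemma sum_fin_four_fun [Fintype V] (F : (Fin 4 → V) → ℚ) :
    ∑ f, F f = ∑ i, ∑ j, ∑ k, ∑ l, F ![i, j, k, l] := by
  simp only [sum_fin_succ_fun, Fintype.sum_unique, Subsingleton.elim default (![] : Fin 0 → V)]

lemma injective_adj_iff_top {n : ℕ} (G : SimpleGraph V) (f : Fin n → V) :
    (Function.Injective f ∧ ∀ a b, G.Adj (f a) (f b) ↔ (⊤ : SimpleGraph (Fin n)).Adj a b) ↔
      ∀ a b, a < b → G.Adj (f a) (f b) := by
  constructor
  · rintro ⟨-, h⟩ a b hab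
    exact (h a b).2 hab.ne
  · intro h
    have h' : ∀ a b, a ≠ b → G.Adj (f a) (f b) := fun a b hab =>
      (lt_or_gt_of_ne hab).elim (h a b) fun hba => (h b a hba).symm
    refine ⟨fun a b hab => by_contra fun hne => (h' a b hne).ne hab, fun a b => ⟨?_, h' a b⟩⟩
    rintro hadj rfl
    exact G.loopless.irrefl _ hadj

lemma injective_adj_iff_cycleGraph_four (G : SimpleGraph V) (f : Fin 4 → V) :
    (Function.Injective f ∧ ∀ a b, G.Adj (f a) (f b) ↔
        (SimpleGraph.cycleGraph 4).Adj a b) ↔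
      ((G.Adj (f 0) (f 1) ∧ G.Adj (f 1) (f 2) ∧ G.Adj (f 2) (f 3) ∧ G.Adj (f 3) (f 0)) ∧
        ((f 0) ≠ (f 2) ∧ ¬ G.Adj (f 0) (f 2)) ∧ ((f 1) ≠ (f 3) ∧ ¬ G.Adj (f 1) (f 3))) := by
  constructor
  · rintro ⟨hi, h⟩
    exact ⟨⟨(h 0 1).2 (by decide), (h 1 2).2 (by decide), (h 2 3).2 (by decide),
      (h 3 0).2 (by decide)⟩,
      ⟨fun h' => absurd (hi h') (by decide), fun h' => absurd ((h 0 2).1 h') (by decide)⟩,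
      ⟨fun h' => absurd (hi h') (by decide), fun h' => absurd ((h 1 3).1 h') (by decide)⟩⟩
  · rintro ⟨⟨h1, h2, h3, h4⟩, ⟨h5, h6⟩, ⟨h7, h8⟩⟩
    have e1 := h1.ne
    have e2 := h2.ne
    have e3 := h3.ne
    have e4 := h4.ne
    have h6' : ¬ G.Adj (f 2) (f 0) := fun h => h6 h.symm
    have h8' : ¬ G.Adj (f 3) (f 1) := fun h => h8 h.symm
    constructor
    · intro a b hab
      fin_cases a <;> fin_cases b <;> simp_all [eq_comm]
    · intro a b
      fin_cases a <;> fin_cases b <;>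
        simp [SimpleGraph.cycleGraph_adj, h1, h2, h3, h4, h6, h8, h1.symm, h2.symm, h3.symm,
          h4.symm, h6', h8'] <;> decide

lemma card_embedding_eq_sum [Fintype V] {n : ℕ} (G : SimpleGraph V) (H : SimpleGraph (Fin n))
    (F : (Fin n → V) → ℚ)
    (h1 : ∀ f, (Function.Injective f ∧ ∀ a b, G.Adj (f a) (f b) ↔ H.Adj a b) → F f = 1)
    (h0 : ∀ f, ¬ (Function.Injective f ∧ ∀ a b, G.Adj (f a) (f b) ↔ H.Adj a b) → F f = 0) :
    (Nat.card (H ↪g G) : ℚ) = ∑ f, F f := by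
  classical
  rw [Nat.card_congr (embeddingEquivSubtype G H), Nat.card_eq_fintype_card,
    Fintype.card_subtype, ← Finset.sum_boole]
  refine Finset.sum_congr rfl fun f _ => ?_
  split_ifs with h
  exacts [(h1 f h).symm, (h0 f h).symm]

lemma nonEntry_adjEntry [DecidableEq V] (G : SimpleGraph V) {i j : V} :
    nonEntry (adjEntry G) i j = open Classical in if i ≠ j ∧ ¬ G.Adj i j then 1 else 0 := by
  by_cases hij : i = j
  · subst hij; simp [nonEntry, adjEntry]
  · by_cases h : G.Adj i j <;> simp [nonEntry, adjEntry, hij, h]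

variable [Fintype V]

lemma copyCount_cycleGraph_three (G : SimpleGraph V) :
    (G.copyCount (SimpleGraph.cycleGraph 3) : ℚ) = triangleSum (adjEntry G) := by
  have h := congrArg (Nat.cast (R := ℚ)) (card_embedding_eq G (⊤ : SimpleGraph (Fin 3)))
  have hc : ∀ f : Fin 3 → V, (∀ a b : Fin 3, a < b → G.Adj (f a) (f b)) ↔
      G.Adj (f 0) (f 1) ∧ G.Adj (f 0) (f 2) ∧ G.Adj (f 1) (f 2) := by
    simp [Fin.forall_fin_succ, and_assoc]
  rw [← copyCount_completeGraph, card_iso_top, card_embedding_eq_sum G ⊤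
    (fun f => adjEntry G (f 0) (f 1) * adjEntry G (f 0) (f 2) * adjEntry G (f 1) (f 2)),
    sum_fin_three_fun] at h
  · rw [SimpleGraph.cycleGraph_three_eq_top, triangleSum, eq_comm, div_mul_eq_mul_div, one_mul,
      div_eq_iff (by norm_num)]
    push_cast [Nat.factorial] at h
    exact h
  · intro f hf
    rw [injective_adj_iff_top, hc] at hf
    simp [adjEntry, hf]
  · intro f hf
    rw [injective_adj_iff_top, hc] at hf
    simp only [adjEntry]
    split_ifs <;> simp_all

lemma copyCount_completeGraph_four (G : SimpleGraph V) :
    (G.copyCount (SimpleGraph.completeGraph (Fin 4)) : ℚ) = fourCliqueSum (adjEntry G) := by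
  have h := congrArg (Nat.cast (R := ℚ)) (card_embedding_eq G (⊤ : SimpleGraph (Fin 4)))
  have hc : ∀ f : Fin 4 → V, (∀ a b : Fin 4, a < b → G.Adj (f a) (f b)) ↔
      G.Adj (f 0) (f 1) ∧ G.Adj (f 0) (f 2) ∧ G.Adj (f 0) (f 3) ∧ G.Adj (f 1) (f 2) ∧
        G.Adj (f 1) (f 3) ∧ G.Adj (f 2) (f 3) := by
    simp [Fin.forall_fin_succ, and_assoc]
  rw [← copyCount_completeGraph, card_iso_top, card_embedding_eq_sum G ⊤
    (fun f => adjEntry G (f 0) (f 1) * adjEntry G (f 0) (f 2) * adjEntry G (f 0) (f 3) *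
      adjEntry G (f 1) (f 2) * adjEntry G (f 1) (f 3) * adjEntry G (f 2) (f 3)),
    sum_fin_four_fun] at h
  · rw [show SimpleGraph.completeGraph (Fin 4) = ⊤ from rfl, fourCliqueSum, eq_comm,
      div_mul_eq_mul_div, one_mul, div_eq_iff (by norm_num)]
    push_cast [Nat.factorial] at h
    exact h
  · intro f hf
    rw [injective_adj_iff_top, hc] at hf
    simp [adjEntry, hf]
  · intro f hf
    rw [injective_adj_iff_top, hc] at hf
    simp only [adjEntry]
    split_ifs <;> simp_all

lemma inducedCount_cycleGraph_four [DecidableEq V] (G : SimpleGraph V) :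
    (inducedCount G (SimpleGraph.cycleGraph 4) : ℚ) = inducedFourCycleSum (adjEntry G) := by
  have h := congrArg (Nat.cast (R := ℚ)) (card_embedding_eq G (SimpleGraph.cycleGraph 4))
  rw [card_iso_cycleGraph_four, card_embedding_eq_sum G (SimpleGraph.cycleGraph 4)
    (fun f => adjEntry G (f 0) (f 1) * adjEntry G (f 1) (f 2) * adjEntry G (f 2) (f 3) *
      adjEntry G (f 3) (f 0) * nonEntry (adjEntry G) (f 0) (f 2) *
      nonEntry (adjEntry G) (f 1) (f 3)), sum_fin_four_fun] at h
  · rw [inducedFourCycleSum, eq_comm, div_mul_eq_mul_div, one_mul, div_eq_iff (by norm_num)]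
    push_cast at h
    exact h
  · intro f hf
    rw [injective_adj_iff_cycleGraph_four] at hf
    simp [nonEntry, adjEntry, hf]
  · intro f hf
    rw [injective_adj_iff_cycleGraph_four] at hf
    simp only [nonEntry_adjEntry, adjEntry]
    split_ifs <;> simp_all

lemma card_edgeFinset_eq (G : SimpleGraph V) [DecidableRel G.Adj] :
    (G.edgeFinset.card : ℚ) = edgeSum (adjEntry G) := by
  have h := congrArg (Nat.cast (R := ℚ)) G.sum_degrees_eq_twice_card_edges
  push_cast at h
  have hd : ∀ i, ∑ j, adjEntry G i j = (G.degree i : ℚ) := by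
    intro i
    rw [← G.card_neighborFinset_eq_degree, G.neighborFinset_eq_filter, ← Finset.sum_boole]
    refine Finset.sum_congr rfl fun j _ => ?_
    by_cases hij : G.Adj i j <;> simp [adjEntry, hij]
  simp only [edgeSum, hd, h]
  ring

lemma sum_neighborFinset (G : SimpleGraph V) [DecidableRel G.Adj] (i : V) (f : V → ℚ) :
    ∑ j ∈ G.neighborFinset i, f j = ∑ j, adjEntry G i j * f j := by
  rw [G.neighborFinset_eq_filter, Finset.sum_filter]
  refine Finset.sum_congr rfl fun j _ => ?_
  by_cases h : G.Adj i j <;> simp [adjEntry, h]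

lemma A5_eq (G : SimpleGraph V) [DecidableRel G.Adj] (r : V → Finset ℕ) :
    A5 G r = (edgeSum (adjEntry G) * (edgeSum (adjEntry G) - 1) / 2
    - triangleSum (adjEntry G)) * ∑ i, restraintCard r i := by
  rw [A5, Nat.cast_choose_two, copyCount_cycleGraph_three, card_edgeFinset_eq]
  rfl

end Embeddings


/-! ### From sums over increasing tuples and edges to sums over all tuples. -/

section OrderedSums

variable {V : Type*} [Fintype V] [LinearOrder V]

lemma sum_lt_eq {f : V → V → ℚ} (hf : ∀ i j, f i j = f j i) :
    ∑ i, ∑ j with i < j, f i j = 1 / 2 * ((∑ i, ∑ j, f i j) - ∑ i, f i i) := by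
  have hp : ∀ i j, f i j = (if i < j then f i j else 0) + (if j < i then f i j else 0)
      + (if i = j then f i j else 0) := by
    intro i j
    rcases lt_trichotomy i j with h | h | h
    · simp [h, h.not_gt, h.ne]
    · simp [h]
    · simp [h, h.not_gt, h.ne']
  have hs : ∑ i, ∑ j, f i j = 2 * (∑ i, ∑ j, if i < j then f i j else 0) + ∑ i, f i i := by
    have hc : (∑ i, ∑ j, if j < i then f i j else 0) = ∑ i, ∑ j, if i < j then f i j else 0 := by
      rw [Finset.sum_comm]
      exact Finset.sum_congr rfl fun i _ => Finset.sum_congr rfl fun j _ => by rw [hf]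
    refine (Finset.sum_congr rfl fun i _ => Finset.sum_congr rfl fun j _ => hp i j).trans ?_
    simp only [Finset.sum_add_distrib, hc, Finset.sum_ite_eq, Finset.mem_univ, if_true]
    ring
  simp only [Finset.sum_filter, hs]
  ring

lemma sum_lt_adj_eq (G : SimpleGraph V) [DecidableRel G.Adj] {f : V → V → ℚ}
    (hf : ∀ i j, f i j = f j i) :
    ∑ i, ∑ j with i < j ∧ G.Adj i j, f i j = 1 / 2 * ∑ i, ∑ j, adjEntry G i j * f i j := by
  have h := sum_lt_eq (f := fun i j => adjEntry G i j * f i j) fun i j => by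
    rw [hf, adjEntry_congr (G.adj_comm i j)]
  have hd : ∀ i, adjEntry G i i = 0 := fun i => by simp [adjEntry]
  simp only [hd, zero_mul, Finset.sum_const_zero, sub_zero] at h
  rw [← h]
  simp only [Finset.sum_filter, ite_and]
  refine Finset.sum_congr rfl fun i _ => Finset.sum_congr rfl fun j _ => ?_
  by_cases hij : G.Adj i j <;> simp [adjEntry, hij]

/-- A triple of distinct indices is increasing under exactly one of six orderings; coincident
indices are accounted for by power sums. -/
lemma sum_lt_lt_eq (s : V → ℚ) :
    ∑ i, ∑ j with i < j, ∑ k with j < k, s i * s j * s k = thirdSymm s := by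
  simp only [Finset.sum_filter]
  set g : V → V → V → ℚ := fun i j k => if i < j then if j < k then s i * s j * s k else 0 else 0
    with hg
  have hL : ∑ i, ∑ j, (if i < j then ∑ k, (if j < k then s i * s j * s k else 0) else 0) =
      ∑ i, ∑ j, ∑ k, g i j k := by
    refine Finset.sum_congr rfl fun i _ => Finset.sum_congr rfl fun j _ => ?_
    by_cases h : i < j <;> simp [hg, h]
  -- When i = j = k, all three pair corrections fire, so two copies are subtracted: hence the
  -- coefficient −2.
  have hp : ∀ i j k, s i * s j * s k = g i j k + g i k j + g j i k + g j k i + g k i j + g k j i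
      + ((if i = j then s i * s i * s k else 0) + (if j = k then s i * s j * s j else 0)
        + (if i = k then s i * s j * s i else 0)
        + (if i = j then if j = k then -2 * (s i * s i * s i) else 0 else 0)) := by
    intro i j k
    simp only [hg]
    rcases lt_trichotomy i j with h | h | h <;> rcases lt_trichotomy j k with h' | h' | h' <;>
      rcases lt_trichotomy i k with h'' | h'' | h'' <;>
      first
        | (exfalso; order)
        | (simp [h, h', h'', h.not_gt, h'.not_gt, h''.not_gt, h.ne, h.ne', h'.ne, h'.ne', h''.ne,
            h''.ne', -mul_eq_mul_right_iff, -mul_eq_mul_left_iff]; try ring)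
        | (subst_vars; simp_all [not_lt_of_gt, ne_of_lt, ne_of_gt]; try ring)
  have c1 : ∑ i, ∑ j, ∑ k, g i k j = ∑ i, ∑ j, ∑ k, g i j k :=
    Finset.sum_congr rfl fun i _ => Finset.sum_comm
  have c2 : ∑ i, ∑ j, ∑ k, g j i k = ∑ i, ∑ j, ∑ k, g i j k := Finset.sum_comm
  have c3 : ∑ i, ∑ j, ∑ k, g k i j = ∑ i, ∑ j, ∑ k, g i j k :=
    (Finset.sum_congr rfl fun i _ => Finset.sum_comm).trans Finset.sum_comm
  have c4 : ∑ i, ∑ j, ∑ k, g j k i = ∑ i, ∑ j, ∑ k, g i j k :=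
    Finset.sum_comm.trans (Finset.sum_congr rfl fun i _ => Finset.sum_comm)
  have c5 : ∑ i, ∑ j, ∑ k, g k j i = ∑ i, ∑ j, ∑ k, g i j k := Finset.sum_comm.trans c3
  have hS : (∑ i, s i) ^ 3 = ∑ i, ∑ j, ∑ k, s i * s j * s k := by
    rw [pow_succ, sq, Finset.sum_mul_sum, Finset.sum_mul]
    refine Finset.sum_congr rfl fun i _ => ?_
    rw [Finset.sum_mul]
    exact Finset.sum_congr rfl fun j _ => Finset.mul_sum _ _ _
  have hS3 : ∑ i, ∑ j, s i * s i * s j = (∑ i, s i) * ∑ i, s i ^ 2 := by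
    rw [mul_comm, Finset.sum_mul_sum]
    simp only [sq]
  have hS4 : ∑ i, ∑ j, s i * s j * s i = (∑ i, s i) * ∑ i, s i ^ 2 := by
    rw [← hS3]
    exact Finset.sum_congr rfl fun i _ => Finset.sum_congr rfl fun j _ => by ring
  have hS2 : ∑ i, ∑ j, s i * s j * s j = (∑ i, s i) * ∑ i, s i ^ 2 := by
    rw [Finset.sum_mul_sum]
    exact Finset.sum_congr rfl fun i _ => Finset.sum_congr rfl fun j _ => by ring
  have hS5 : ∑ i, -2 * (s i * s i * s i) = -2 * ∑ i, s i ^ 3 := by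
    rw [Finset.mul_sum]
    exact Finset.sum_congr rfl fun i _ => by ring
  have hA := Finset.sum_congr (s₁ := Finset.univ) rfl fun i _ =>
    Finset.sum_congr (s₁ := Finset.univ) rfl fun j _ =>
      Finset.sum_congr (s₁ := Finset.univ) rfl fun k _ => hp i j k
  simp only [Finset.sum_add_distrib, c1, c2, c3, c4, c5, Finset.sum_ite_irrel,
    Finset.sum_const_zero, Finset.sum_ite_eq, Finset.mem_univ, if_true, hS2, hS3, hS4, hS5] at hA
  rw [hL, thirdSymm, hS, hA]
  ring

variable (G : SimpleGraph V) [DecidableRel G.Adj] (r : V → Finset ℕ)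

lemma A0_eq : A0 G =
    edgeSum (adjEntry G) * (edgeSum (adjEntry G) - 1) * (edgeSum (adjEntry G) - 2) / 6
      - (edgeSum (adjEntry G) - 2) * triangleSum (adjEntry G)
      - inducedFourCycleSum (adjEntry G) + 2 * fourCliqueSum (adjEntry G) := by
  have hch : ∀ m : ℕ, (m.choose 3 : ℚ) = m * (m - 1) * (m - 2) / 6 := by
    intro m
    induction m with
    | zero => simp
    | succ m ih =>
      rw [Nat.choose_succ_succ, Nat.cast_add, ih, Nat.cast_choose_two]
      push_cast
      ring
  rw [A0, hch, copyCount_cycleGraph_three, inducedCount_cycleGraph_four,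
    copyCount_completeGraph_four, card_edgeFinset_eq]

lemma A1_eq : A1 r = thirdSymm (restraintCard r) := sum_lt_lt_eq (restraintCard r)

lemma sum_lt_card_mul_card :
    ∑ i, ∑ j with i < j, ((r i).card : ℚ) * ((r j).card : ℚ) =
      secondSymm (restraintCard r) := by
  rw [sum_lt_eq (f := fun i j => ((r i).card : ℚ) * ((r j).card : ℚ)) fun i j => mul_comm _ _,
    ← Finset.sum_mul_sum, secondSymm]
  simp only [restraintCard, sq]
  ring

lemma A2_eq : A2 G r = (edgeSum (adjEntry G) - 1) * secondSymm (restraintCard r) := by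
  rw [A2, card_edgeFinset_eq, sum_lt_card_mul_card]

lemma A3_eq : A3 G r = secondSymm (restraintCard r)
    - 1 / 2 * ∑ i, ∑ j, adjEntry G i j * (restraintCard r i * restraintCard r j) := by
  rw [A3, ← sum_lt_card_mul_card, ← sum_lt_adj_eq G fun i j => mul_comm _ _, eq_sub_iff_add_eq,
    ← Finset.sum_add_distrib]
  refine Finset.sum_congr rfl fun i _ => ?_
  simp only [← Finset.filter_filter]
  rw [add_comm]
  exact Finset.sum_filter_add_sum_filter_not _ _ _

lemma sum_lt_adj_pairCard :
    ∑ i, ∑ j with i < j ∧ G.Adj i j, ((r i ∩ r j).card : ℚ) = edgePairSum (adjEntry G) r :=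
  sum_lt_adj_eq G (pairCard_comm r)

lemma A4_eq : A4 G r = -((∑ i, restraintCard r i) * edgePairSum (adjEntry G) r
    - 1 / 2 * ∑ i, ∑ j, adjEntry G i j *
        (pairCard r i j * (restraintCard r i + restraintCard r j))) := by
  rw [A4, ← sum_lt_adj_pairCard, ← sum_lt_adj_eq G fun i j => by rw [pairCard_comm, add_comm],
    Finset.mul_sum, ← Finset.sum_sub_distrib]
  congr 1
  refine Finset.sum_congr rfl fun i _ => ?_
  rw [Finset.mul_sum, ← Finset.sum_sub_distrib]
  refine Finset.sum_congr rfl fun j hj => ?_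
  have hij : i ≠ j := (Finset.mem_filter.1 hj).2.1.ne
  have hk : ∑ k with k ≠ i ∧ k ≠ j, ((r k).card : ℚ) =
      (∑ k, restraintCard r k) - (restraintCard r i + restraintCard r j) := by
    have hf : (Finset.univ.filter fun k => k ≠ i ∧ k ≠ j) = Finset.univ \ {i, j} := by
      ext k; simp
    rw [hf, eq_sub_iff_add_eq, ← Finset.sum_pair (f := restraintCard r) hij]
    exact Finset.sum_sdiff (Finset.subset_univ _)
  rw [hk, pairCard]
  ring

lemma A6_eq : A6 G r = -((edgeSum (adjEntry G) - 1) * edgePairSum (adjEntry G) r) := by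
  rw [A6, card_edgeFinset_eq, sum_lt_adj_pairCard, neg_mul]

lemma A7'_eq : A7' G r = 1 / 2 * ∑ i, ∑ j, ∑ k,
    adjEntry G i j * adjEntry G i k * adjEntry G j k * pairCard r i j := by
  have hc : ∀ i j, ((G.neighborFinset i ∩ G.neighborFinset j).card : ℚ) =
      ∑ k, adjEntry G i k * adjEntry G j k := by
    intro i j
    rw [← sum_neighborFinset, Finset.card_eq_sum_ones, ← Finset.filter_mem_eq_inter,
      Finset.sum_filter, Nat.cast_sum]
    refine Finset.sum_congr rfl fun k _ => ?_
    by_cases h : G.Adj j k <;> simp [adjEntry, h]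
  rw [A7', sum_lt_adj_eq G (f := fun i j =>
    ((G.neighborFinset i ∩ G.neighborFinset j).card : ℚ) * ((r i ∩ r j).card : ℚ))
    fun i j => by rw [Finset.inter_comm, Finset.inter_comm (r i)]]
  simp only [hc, Finset.sum_mul, Finset.mul_sum]
  refine Finset.sum_congr rfl fun i _ => Finset.sum_congr rfl fun j _ =>
    Finset.sum_congr rfl fun k _ => ?_
  rw [pairCard]
  ring

lemma A7''_eq : A7'' G r = -(1 / 2 * ∑ i, ∑ j, ∑ k,
    adjEntry G i j * adjEntry G i k * (if j = k then 0 else pairCard r j k)) := by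
  rw [A7'', Finset.mul_sum]
  congr 1
  refine Finset.sum_congr rfl fun i _ => ?_
  have h := sum_lt_eq (f := fun j k => adjEntry G i j * adjEntry G i k *
    (if j = k then 0 else pairCard r j k)) fun j k => by
      rw [mul_comm (adjEntry G i j), pairCard_comm]; simp only [eq_comm]
  simp only [if_true, mul_zero, Finset.sum_const_zero, sub_zero] at h
  rw [← h, sum_neighborFinset]
  refine Finset.sum_congr rfl fun j _ => ?_
  rw [Finset.sum_filter, sum_neighborFinset, Finset.sum_filter, Finset.mul_sum]
  refine Finset.sum_congr rfl fun k _ => ?_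
  by_cases hjk : j < k
  · simp only [hjk, hjk.ne, if_true, if_false, pairCard]
    ring
  · simp [hjk]

/-- Inclusion–exclusion over N(i) ∪ N(j). The two neighbourhood terms agree after exchanging i and
j, and the overlap is a triangle sum. Its coefficient −1/4 combines with the 1/12 of `A8''_eq` into
the −1/6 of `coeffThree`. -/
lemma A8'_eq : A8' G r = 1 / 2 * (∑ i, ∑ j, ∑ k,
      adjEntry G i j * adjEntry G i k * (if j = k then 0 else tripleCard r i j k))
    - 1 / 4 * ∑ i, ∑ j, ∑ k,
      adjEntry G i j * adjEntry G i k * adjEntry G j k * tripleCard r i j k := by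
  have hd : ∀ i, adjEntry G i i = 0 := fun i => by simp [adjEntry]
  have hc : ∀ i j, ∑ k ∈ G.neighborFinset i ∪ G.neighborFinset j with k ≠ i ∧ k ≠ j,
      ((r i ∩ r j ∩ r k).card : ℚ) =
      ∑ k, (adjEntry G i k * (if j = k then 0 else tripleCard r i j k)
        + adjEntry G j k * (if i = k then 0 else tripleCard r i j k)
        - adjEntry G i k * adjEntry G j k * tripleCard r i j k) := by
    intro i j
    have hf : ((G.neighborFinset i ∪ G.neighborFinset j).filter fun k => k ≠ i ∧ k ≠ j) =
        Finset.univ.filter fun k => (G.Adj i k ∨ G.Adj j k) ∧ k ≠ i ∧ k ≠ j := by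
      ext k; simp
    rw [hf, Finset.sum_filter]
    refine Finset.sum_congr rfl fun k _ => ?_
    rcases eq_or_ne k i with rfl | hi
    · simp [hd]
    rcases eq_or_ne k j with rfl | hj
    · simp [hd]
    by_cases h1 : G.Adj i k <;> by_cases h2 : G.Adj j k <;>
      simp [adjEntry, h1, h2, hi, hi.symm, hj, hj.symm, tripleCard]
  rw [A8', sum_lt_adj_eq G (f := fun i j =>
    ∑ k ∈ G.neighborFinset i ∪ G.neighborFinset j with k ≠ i ∧ k ≠ j,
      ((r i ∩ r j ∩ r k).card : ℚ))
    fun i j => by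
      rw [Finset.union_comm, Finset.inter_comm (r i)]
      simp only [and_comm]]
  have hs : ∑ i, ∑ j, ∑ k, adjEntry G i j *
        (adjEntry G j k * (if i = k then 0 else tripleCard r i j k)) =
      ∑ i, ∑ j, ∑ k,
        adjEntry G i j * (adjEntry G i k * (if j = k then 0 else tripleCard r i j k)) := by
    rw [Finset.sum_comm]
    refine Finset.sum_congr rfl fun i _ => Finset.sum_congr rfl fun j _ =>
      Finset.sum_congr rfl fun k _ => ?_
    rw [adjEntry_congr (G.adj_comm j i), tripleCard_swap]
  have hm : ∀ i j, adjEntry G i j *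
      ∑ k, (adjEntry G i k * (if j = k then 0 else tripleCard r i j k)
        + adjEntry G j k * (if i = k then 0 else tripleCard r i j k)
        - adjEntry G i k * adjEntry G j k * tripleCard r i j k) =
      (∑ k, adjEntry G i j * (adjEntry G i k * (if j = k then 0 else tripleCard r i j k)))
        + (∑ k, adjEntry G i j * (adjEntry G j k * (if i = k then 0 else tripleCard r i j k)))
        - ∑ k, adjEntry G i j * (adjEntry G i k * adjEntry G j k * tripleCard r i j k) := by
    intro i j
    simp only [Finset.mul_sum, mul_add, mul_sub, Finset.sum_add_distrib, Finset.sum_sub_distrib]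
  simp only [hc, hm]
  simp only [Finset.sum_add_distrib, Finset.sum_sub_distrib, hs]
  simp only [mul_assoc]
  ring

lemma A8''_eq : A8'' G r = 1 / 12 * ∑ i, ∑ j, ∑ k,
    adjEntry G i j * adjEntry G i k * adjEntry G j k * tripleCard r i j k := by
  have hc : ∀ i j, ∑ k ∈ G.neighborFinset i ∩ G.neighborFinset j, ((r i ∩ r j ∩ r k).card : ℚ) =
      ∑ k, adjEntry G i k * (adjEntry G j k * tripleCard r i j k) := by
    intro i j
    rw [← sum_neighborFinset, ← Finset.filter_mem_eq_inter, Finset.sum_filter]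
    refine Finset.sum_congr rfl fun k _ => ?_
    by_cases h : G.Adj j k <;> simp [adjEntry, h, tripleCard]
  rw [A8'', sum_lt_adj_eq G (f := fun i j =>
    ∑ k ∈ G.neighborFinset i ∩ G.neighborFinset j, ((r i ∩ r j ∩ r k).card : ℚ))
    fun i j => by rw [Finset.inter_comm, Finset.inter_comm (r i)], ← mul_assoc]
  simp only [hc]
  norm_num
  simp only [Finset.mul_sum, mul_assoc]

end OrderedSums


/-! ### The sharp range of x, and uniqueness of the coefficients. -/

section Main

lemma mem_le_maxForbidden {V : Type*} [Fintype V] {r : V → Finset ℕ} {v : V} {c : ℕ} (h : c ∈ r v) :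
    c ≤ maxForbidden r :=
  Finset.le_sup (f := id) (Finset.mem_biUnion.2 ⟨v, Finset.mem_univ v, h⟩)

variable {V : Type*} [Fintype V] [DecidableEq V]

/-- Without restraints, the number of colourings with `x` colours is divisible by `x`. -/
lemma dvd_card_colourings [Nonempty V] (G : SimpleGraph V) {r : V → Finset ℕ}
    (hr : ∀ v, r v = ∅) (x : ℕ) : x ∣ (colourings G r x).card := by
  obtain ⟨v⟩ := ‹Nonempty V›
  have hmaps : ∀ c ∈ colourings G r x, c v ∈ Finset.Icc 1 x := fun c hc =>
    (mem_colourings.1 hc).1 v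
  rw [Finset.card_eq_sum_card_fiberwise hmaps]
  have hcard : ∀ y ∈ Finset.Icc 1 x, ((colourings G r x).filter fun c => c v = y).card =
      ((colourings G r x).filter fun c => c v = 1).card := by
    intro y hy
    rw [Finset.mem_Icc] at hy
    -- Exchanging the colours 1 and y shows that each colour is used at the chosen vertex equally
    -- often.
    have hsw : ∀ z ∈ Finset.Icc 1 x, Equiv.swap 1 y z ∈ Finset.Icc 1 x := by
      intro z hz
      rw [Equiv.swap_apply_def]
      rw [Finset.mem_Icc] at hz ⊢
      split_ifs <;> omega
    have hcol : ∀ c ∈ colourings G r x, (fun w => Equiv.swap 1 y (c w)) ∈ colourings G r x := by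
      intro c hc
      rw [mem_colourings] at hc ⊢
      refine ⟨fun w => hsw _ (hc.1 w), fun i j hij h => hc.2.1 i j hij ?_, fun w => by simp [hr]⟩
      exact (Equiv.swap 1 y).injective h
    refine Finset.card_nbij' (fun c w => Equiv.swap 1 y (c w)) (fun c w => Equiv.swap 1 y (c w))
      ?_ ?_ ?_ ?_
    · intro c hc
      rw [Finset.mem_coe, Finset.mem_filter] at hc ⊢
      exact ⟨hcol c hc.1, by simp [hc.2]⟩
    · intro c hc
      rw [Finset.mem_coe, Finset.mem_filter] at hc ⊢
      exact ⟨hcol c hc.1, by simp [hc.2]⟩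
    · intro c _; simp
    · intro c _; simp
  rw [Finset.sum_congr rfl hcard]
  simp

/-- `exists_polynomial` leaves out only x = 0. That value is in range only when no colour is
forbidden, and then divisibility of the count by x forces P(0) = 0. -/
theorem exists_restrainedPolynomial (hn : 3 ≤ Fintype.card V) (G : SimpleGraph V)
    (r : V → Finset ℕ) (hr : ∀ v, ∀ c ∈ r v, 1 ≤ c) :
    ∃ P : ℤ[X], HasLeadingCoeffs P (adjEntry G) r ∧
      ∀ x : ℕ, maxForbidden r ≤ x → ((colourings G r x).card : ℤ) = P.eval (x : ℤ) := by
  have : Nonempty V := Fintype.card_pos_iff.1 (by omega)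
  obtain ⟨k, hk⟩ := exists_nat_gt (edgeSum (adjEntry G))
  obtain ⟨P, hP, hPx⟩ := exists_polynomial hn (max (maxForbidden r) 1) (le_max_right _ _) k G hk r
    fun v c hc => Finset.mem_Icc.2 ⟨hr v c hc, (mem_le_maxForbidden hc).trans (le_max_left _ _)⟩
  refine ⟨P, hP, fun x hx => ?_⟩
  rcases Nat.eq_zero_or_pos x with rfl | hx0
  · have hempty : ∀ v, r v = ∅ := by
      intro v
      rw [Finset.eq_empty_iff_forall_notMem]
      intro c hc
      have h1 := hr v c hc
      have h2 := mem_le_maxForbidden hc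
      omega
    have hP0 : P.coeff 0 = 0 := by
      refine coeff_zero_eq_zero_of_dvd_eval (K := max (maxForbidden r) 1) fun x hx => ?_
      rw [← hPx x hx]
      exact_mod_cast dvd_card_colourings G hempty x
    rw [Nat.cast_zero, ← coeff_zero_eq_eval_zero, hP0]
    exact_mod_cast zero_dvd_iff.1 (dvd_card_colourings G hempty 0)
  · exact hPx x (max_le hx hx0)

lemma hasCoefficients_iff {G : SimpleGraph V} [DecidableRel G.Adj] {r : V → Finset ℕ} {P : ℤ[X]}
    (hdeg : P.natDegree ≤ Fintype.card V)
    (hP : ∀ x : ℕ, maxForbidden r ≤ x → ((colourings G r x).card : ℤ) = P.eval (x : ℤ))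
    (a : Fin (Fintype.card V + 1) → ℤ) :
    HasCoefficients G r a ↔
      ∀ i : Fin (Fintype.card V + 1), (-1) ^ (Fintype.card V - (i : ℕ)) * a i = P.coeff i := by
  constructor
  · intro h
    set Q : ℤ[X] := ∑ i : Fin (Fintype.card V + 1),
      C ((-1) ^ (Fintype.card V - (i : ℕ)) * a i) * X ^ (i : ℕ) with hQ
    have hPQ : P = Q := by
      refine eq_of_infinite_eval_eq P Q ?_
      refine Set.Infinite.mono (s := Nat.cast '' Set.Ici (maxForbidden r)) ?_
        ((Set.Ici_infinite _).image Nat.cast_injective.injOn)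
      rintro _ ⟨x, hx, rfl⟩
      rw [Set.mem_ofPred_eq, ← hP x hx, ← restrainedCount_eq, h x hx, hQ, eval_finsetSum]
      simp
    intro i
    rw [hPQ, hQ, finsetSum_coeff]
    simp only [coeff_C_mul, coeff_X_pow, Fin.val_inj, mul_ite, mul_one, mul_zero,
      Finset.sum_ite_eq, Finset.mem_univ, if_true]
  · intro h x hx
    rw [restrainedCount_eq, hP x hx, eval_eq_sum_range' (Nat.lt_succ_of_le hdeg),
      ← Fin.sum_univ_eq_sum_range (fun i => P.coeff i * (x : ℤ) ^ i)]
    exact Finset.sum_congr rfl fun i _ => by rw [h i]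

end Main

end RestrainedColouring

theorem mainTheorem8 {V : Type*} [Fintype V] [LinearOrder V]
    (G : SimpleGraph V) [DecidableRel G.Adj] (hn : 3 ≤ Fintype.card V)
    (r : V → Finset ℕ) (hr : ∀ v, ∀ c ∈ r v, 1 ≤ c) :
    (∃! a : Fin (Fintype.card V + 1) → ℤ, RestrainedColouring.HasCoefficients G r a) ∧
    ∀ a : Fin (Fintype.card V + 1) → ℤ, RestrainedColouring.HasCoefficients G r a →
      (a ⟨Fintype.card V - 3, by omega⟩ : ℚ) =
        RestrainedColouring.A0 G + RestrainedColouring.A1 r + RestrainedColouring.A2 G r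
          + RestrainedColouring.A3 G r + RestrainedColouring.A4 G r + RestrainedColouring.A5 G r
          + RestrainedColouring.A6 G r + RestrainedColouring.A7 G r + RestrainedColouring.A8 G r := by
  obtain ⟨P, hP, hPx⟩ := RestrainedColouring.exists_restrainedPolynomial hn G r hr
  have hiff := RestrainedColouring.hasCoefficients_iff hP.natDegree_le hPx
  have hsq : ∀ k : ℕ, ((-1 : ℤ) ^ k) * (-1) ^ k = 1 := fun k => by
    rw [← mul_pow]; norm_num
  refine ⟨⟨fun i => (-1) ^ (Fintype.card V - (i : ℕ)) * P.coeff i, ?_, ?_⟩, ?_⟩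
  · refine (hiff _).2 fun i => ?_
    rw [← mul_assoc, hsq, one_mul]
  · intro a ha
    ext i
    rw [← (hiff a).1 ha i, ← mul_assoc, hsq, one_mul]
  · intro a ha
    have h := (hiff a).1 ha ⟨Fintype.card V - 3, by omega⟩
    -- The hypothesis `3 ≤ n` turns the truncated exponent n − (n − 3) into 3, so the sign is −1.
    rw [Fin.val_mk, Nat.sub_sub_self hn] at h
    have h' := hP.coeff_three
    rw [← h] at h'
    push_cast at h'
    rw [RestrainedColouring.A0_eq, RestrainedColouring.A1_eq, RestrainedColouring.A2_eq,
      RestrainedColouring.A3_eq, RestrainedColouring.A4_eq, RestrainedColouring.A5_eq,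
      RestrainedColouring.A6_eq, RestrainedColouring.A7, RestrainedColouring.A7'_eq,
      RestrainedColouring.A7''_eq, RestrainedColouring.A8, RestrainedColouring.A8'_eq,
      RestrainedColouring.A8''_eq]
    rw [RestrainedColouring.coeffThree] at h'
    linear_combination -h'
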